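/- Let nodes be distributed as a homogeneous Poisson point process of density $\lambda>0$ on a planar region $\mathcal A$ of finite area, and let $\mathcal A_\mu\subseteq\mathcal A$ be the disk of radius $R>0$ covered by a drone hovering at altitude $h>0$ above its centre; put $d=\sqrt{h^2+R^2}$. Independently of everything else, each node transmits with probability $a\in[0,1]$ (slotted ALOHA), and its signal has a power gain $G_x$; the gains are i.i.d. and Gamma distributed with density $f_G(g)=\frac{m^m g^{m-1}}{\Gamma(m)}e^{-mg}$, $g\ge 0$ (Nakagami-$m$ fading, $m$ a positive integer). Let $\tilde\Psi_\mu$ be the set of transmitting nodes in $\mathcal A_\mu$, $D_x\in[h,d]$ the distance from node $x$ to the drone, $\eta>0$ the path-loss exponent, $P>0$ the transmission power and $\sigma_n^2>0$ the noise variance. For $x_n\in\tilde\Psi_\mu$ put $$\mathrm{SINR}^n_\mu=\frac{P\,G_{x_n}D_{x_n}^{-\eta}}{\sum_{x\in\tilde\Psi_\mu\setminus\{x_n\}}P\,G_xD_x^{-\eta}+\sigma_n^2},\qquad I_n=\sum_{x\in\tilde\Psi_\mu\setminus\{x_n\}}G_xD_x^{-\eta}+\frac{\sigma_n^2}{P}.$$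 Then, for every SINR threshold $\beta\ge 1$, the success probability is $$P^s_\mu=\mathbb P\Big(\bigcup_{x_n\in\tilde\Psi_\mu}\{\mathrm{SINR}^n_\mu\ge\beta\}\Big)=\mathbb E\Big[\sum_{x_n\in\tilde\Psi_\mu}\mathbf 1_{\{\mathrm{SINR}^n_\mu\ge\beta\}}\Big]=2a\pi\lambda\int_h^d\sum_{k=0}^{m-1}\frac{(-m\beta r^\eta)^k}{k!}\Big[\frac{\partial^k}{\partial s^k}\mathcal L_I(s)\Big]_{s=m\beta r^\eta}r\,dr,$$ where $$\mathcal L_I(s)=e^{-s\sigma_n^2/P}\exp\Big(-2\pi\lambda a\int_h^d\Big(1-\Big(1+\frac{s\,r^{-\eta}}{m}\Big)^{-m}\Big)r\,dr\Big).$$ Moreover, for $s\ge 0$, $\mathcal L_I(s)$ is the Laplace transform of the distribution of the normalized interference-plus-noise power seen by a transmitting node: there is a probability law $Q$ on $\mathbb R$ such that for all Borel sets $B\subseteq\mathbb R^2$ and $C\subseteq\mathbb R$ $$\mathbb E\big[\#\{x_n\in\tilde\Psi_\mu: x_n\in B,\ I_n\in C\}\big]=\mathbb E\big[\#\{x_n\in\tilde\Psi_\mu:x_n\in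 B\}\big]\,Q(C),$$ and $\int e^{-sy}\,Q(dy)=\mathcal L_I(s)$. -/

import Mathlib

open MeasureTheory ProbabilityTheory

/-- The ground plane. -/
abbrev Plane : Type := EuclideanSpace ℝ (Fin 2)

/-- A random finite field of nodes on the plane: the nodes are those of index `n < card ω`; node `n`
sits at `pos n ω`, transmits in the current slot iff `tx n ω = true`, and has power gain
`gain n ω`. -/
structure NodeField (Ω : Type*) where
  card : Ω → ℕ
  pos : ℕ → Ω → Plane
  tx : ℕ → Ω → Bool
  gain : ℕ → Ω → ℝ

namespace NodeField

variable {Ω : Type*}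

open Classical in
/-- Number of nodes (transmitting or not) located in `B`. -/
noncomputable def count (F : NodeField Ω) (B : Set Plane) (ω : Ω) : ℕ :=
  ((Finset.range (F.card ω)).filter (fun n => F.pos n ω ∈ B)).card

open Classical in
/-- The transmitting nodes located in `B`. -/
noncomputable def active (F : NodeField Ω) (B : Set Plane) (ω : Ω) : Finset ℕ :=
  (Finset.range (F.card ω)).filter (fun n => F.pos n ω ∈ B ∧ F.tx n ω = true)

/-- The node positions form a homogeneous Poisson point process of density `lam` on the region `A`:
the number of nodes in a Borel set `B ⊆ A` is Poisson with mean `lam * |B|`, and the numbers of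
nodes in pairwise disjoint Borel sets are independent. -/
structure IsHomogeneousPPP [MeasurableSpace Ω] (F : NodeField Ω) (μ : Measure Ω)
    (A : Set Plane) (lam : ℝ) : Prop where
  measurable_card : Measurable F.card
  measurable_pos : ∀ n, Measurable (F.pos n)
  mem_region : ∀ᵐ ω ∂μ, ∀ n < F.card ω, F.pos n ω ∈ A
  poisson_count : ∀ B ⊆ A, MeasurableSet B →
    HasLaw (F.count B) (poissonMeasure (lam * volume.real B).toNNReal) μ
  indep_count : ∀ (k : ℕ) (B : Fin k → Set Plane), (∀ j, B j ⊆ A) → (∀ j, MeasurableSet (B j)) →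
    Pairwise (fun i j => Disjoint (B i) (B j)) → iIndepFun (fun j => F.count (B j)) μ

/-- Slotted ALOHA with transmission probability `a` and Nakagami-`m` fading: the node positions, the
transmission decisions and the gains are independent of one another, the decisions are i.i.d.
Bernoulli(`a`) and the gains are i.i.d. Gamma of shape `m` and rate `m`. -/
structure HasAlohaNakagamiMarks [MeasurableSpace Ω] (F : NodeField Ω) (μ : Measure Ω)
    (a : ℝ) (m : ℕ) : Prop where
  measurable_tx : ∀ n, Measurable (F.tx n)
  measurable_gain : ∀ n, Measurable (F.gain n)
  tx_prob : ∀ n, μ {ω | F.tx n ω = true} = ENNReal.ofReal a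
  gain_law : ∀ n, HasLaw (F.gain n) (gammaMeasure m m) μ
  indep_tx_gain : ∀ n, IndepFun (F.tx n) (F.gain n) μ
  iIndep_marks : iIndepFun (fun n ω => (F.tx n ω, F.gain n ω)) μ
  indep_pos_marks : IndepFun (fun ω => (F.card ω, fun n => F.pos n ω))
    (fun ω n => (F.tx n ω, F.gain n ω)) μ

/-- The circular region covered from the hovering location above `c`. -/
def coverage (c : Plane) (R : ℝ) : Set Plane := Metric.closedBall c R

/-- Distance between the ground point `x` and the drone at altitude `h` above `c`. -/
noncomputable def droneDist (c : Plane) (h : ℝ) (x : Plane) : ℝ :=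
  Real.sqrt (‖x - c‖ ^ 2 + h ^ 2)

/-- SINR at the drone of node `n`, all other transmitting nodes of the covered region being
interferers; `P` is the transmission power, `noise` the noise variance. -/
noncomputable def sinr (F : NodeField Ω) (c : Plane) (R h η P noise : ℝ) (n : ℕ) (ω : Ω) : ℝ :=
  P * F.gain n ω * droneDist c h (F.pos n ω) ^ (-η) /
    ((∑ j ∈ (F.active (coverage c R) ω).erase n,
      P * F.gain j ω * droneDist c h (F.pos j ω) ^ (-η)) + noise)

/-- Normalized interference-plus-noise power seen by node `n`. -/
noncomputable def interference (F : NodeField Ω) (c : Plane) (R h η P noise : ℝ) (n : ℕ)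
    (ω : Ω) : ℝ :=
  (∑ j ∈ (F.active (coverage c R) ω).erase n,
    F.gain j ω * droneDist c h (F.pos j ω) ^ (-η)) + noise / P

/-- The event that some transmission from the covered region succeeds. -/
def successEvent (F : NodeField Ω) (c : Plane) (R h η P noise β : ℝ) : Set Ω :=
  {ω | ∃ n ∈ F.active (coverage c R) ω, β ≤ F.sinr c R h η P noise n ω}

open Classical in
/-- The number of successful transmissions. -/
noncomputable def successCount (F : NodeField Ω) (c : Plane) (R h η P noise β : ℝ) (ω : Ω) : ℝ :=
  ∑ n ∈ F.active (coverage c R) ω, if β ≤ F.sinr c R h η P noise n ω then 1 else 0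

open Classical in
/-- `Q` is the distribution of the interference-plus-noise power seen by a transmitting node,
whatever its position (Palm distribution): the expected number of transmitting nodes in `B` whose
interference lies in `C` is `Q C` times the expected number of transmitting nodes in `B`. -/
def IsInterferenceLaw [MeasurableSpace Ω] (F : NodeField Ω) (μ : Measure Ω) (c : Plane)
    (R h η P noise : ℝ) (Q : Measure ℝ) : Prop :=
  IsProbabilityMeasure Q ∧
  ∀ (B : Set Plane) (C : Set ℝ), MeasurableSet B → MeasurableSet C →
    ∫⁻ ω, (((F.active (coverage c R) ω).filter (fun n =>
        F.pos n ω ∈ B ∧ F.interference c R h η P noise n ω ∈ C)).card : ENNReal) ∂μ =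
      (∫⁻ ω, (((F.active (coverage c R) ω).filter (fun n => F.pos n ω ∈ B)).card : ENNReal) ∂μ)
        * Q C

end NodeField

/-- The function `L_I(s)`. -/
noncomputable def laplaceI (lam a η P noise h d : ℝ) (m : ℕ) (s : ℝ) : ℝ :=
  Real.exp (-s * noise / P) *
    Real.exp (-2 * Real.pi * lam * a *
      ∫ r in h..d, (1 - (1 + s * r ^ (-η) / m) ^ (-(m : ℤ))) * r)

/-!
A finite point process is Poisson as soon as its generating functional is
`exp (∫ (u - 1) ∂ν)`, a property that survives i.i.d. marking, thinning and mapping; so the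
transmitting nodes of the covered region, marked by their gains, form a Poisson process.
Differentiating the generating functional gives the Campbell–Mecke formula, hence Slivnyak's
theorem: from a transmitting node the others look like the whole process. The interference is
therefore independent of the position and gain of that node, and its Laplace transform is the
generating functional evaluated at an exponential. A transmission succeeds when a Gamma gain exceeds
a multiple of the interference; the Erlang tail `exp (-t) * ∑ t ^ k / k!` turns the
probability of this into derivatives of the Laplace transform. For `β ≥ 1` a successful node is
received more strongly than any other, so at most one succeeds and the union bound is an equality.
-/

theorem hasSum_poisson_smul_pow (r : NNReal) (z : ℂ) :
    HasSum (fun n : ℕ => (Real.exp (-r) * r ^ n / n.factorial) • z ^ n)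
      (Complex.exp (r * (z - 1))) := by
  have h := (NormedSpace.expSeries_div_hasSum_exp ((r : ℂ) * z)).mul_left (Complex.exp (-r))
  rw [← Complex.exp_eq_exp_ℂ, ← Complex.exp_add,
    show -(r : ℂ) + r * z = r * (z - 1) by ring] at h
  refine h.congr_fun fun n => ?_
  rw [Complex.real_smul]
  push_cast
  ring

theorem integral_pow_poissonMeasure (r : NNReal) (z : ℂ) :
    ∫ n, z ^ n ∂(poissonMeasure r) = Complex.exp (r * (z - 1)) := by
  rw [integral_poissonMeasure]
  exact (hasSum_poisson_smul_pow r z).tsum_eq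

theorem gammaMeasure_eq_withDensity_restrict_Ici (a r : ℝ) :
    gammaMeasure a r = (volume.restrict (Set.Ici 0)).withDensity
      (fun x => ENNReal.ofReal (r ^ a / Real.Gamma a * x ^ (a - 1) * Real.exp (-(r * x)))) := by
  rw [gammaMeasure, ← withDensity_indicator measurableSet_Ici]
  congr 1
  ext x
  by_cases hx : 0 ≤ x
  · rw [gammaPDF_of_nonneg hx, Set.indicator_of_mem (Set.mem_Ici.2 hx)]
  · rw [gammaPDF_of_neg (not_le.1 hx), Set.indicator_of_notMem (mt Set.mem_Ici.1 hx)]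

theorem ae_nonneg_gammaMeasure (a r : ℝ) : ∀ᵐ x ∂(gammaMeasure a r), 0 ≤ x := by
  rw [gammaMeasure_eq_withDensity_restrict_Ici]
  exact (withDensity_absolutelyContinuous _ _).ae_le (ae_restrict_mem measurableSet_Ici)

theorem integral_exp_neg_mul_gammaMeasure {a r s : ℝ} (ha : 0 < a) (hr : 0 < r) (hs : -r < s) :
    ∫ g, Real.exp (-s * g) ∂(gammaMeasure a r) = (1 + s / r) ^ (-a) := by
  have hrs : 0 < r + s := by linarith
  have := Real.Gamma_pos_of_pos ha
  have hdens : ∀ x ∈ Set.Ioi (0 : ℝ), (ENNReal.ofReal (r ^ a / Real.Gamma a * x ^ (a - 1) *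
      Real.exp (-(r * x)))).toReal • Real.exp (-s * x) =
      r ^ a / Real.Gamma a * (x ^ (a - 1) * Real.exp (-((r + s) * x))) := fun x hx => by
    have hx : 0 < x := hx
    rw [ENNReal.toReal_ofReal (by positivity), smul_eq_mul, mul_assoc, mul_assoc, ← Real.exp_add]
    ring_nf
  rw [gammaMeasure_eq_withDensity_restrict_Ici, integral_withDensity_eq_integral_toReal_smul
    (by fun_prop) (by simp), integral_Ici_eq_integral_Ioi,
    setIntegral_congr_fun measurableSet_Ioi hdens, integral_const_mul,
    Real.integral_rpow_mul_exp_neg_mul_Ioi ha hrs,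
    show 1 + s / r = (r + s) / r by field_simp, Real.rpow_neg (by positivity),
    Real.div_rpow hrs.le hr.le, Real.div_rpow one_pos.le hrs.le, Real.one_rpow]
  field_simp

theorem hasDerivAt_neg_exp_neg_mul_sum_pow_div_factorial (m : ℕ) (x : ℝ) :
    HasDerivAt (fun x : ℝ => -(Real.exp (-x) * ∑ k ∈ Finset.range (m + 1), x ^ k / k.factorial))
      (x ^ m / m.factorial * Real.exp (-x)) x := by
  have hexp : HasDerivAt (fun x : ℝ => Real.exp (-x)) (-Real.exp (-x)) x := by
    simpa using (hasDerivAt_id x).neg.exp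
  induction m with
  | zero => simpa using hexp.fun_neg
  | succ m ih =>
    have hlast : HasDerivAt (fun x : ℝ => -(Real.exp (-x) * (x ^ (m + 1) / (m + 1).factorial)))
        (x ^ (m + 1) / (m + 1).factorial * Real.exp (-x) - x ^ m / m.factorial * Real.exp (-x))
        x := by
      refine (hexp.mul ((hasDerivAt_pow (m + 1) x).div_const _)).neg.congr_deriv ?_
      rw [Nat.add_sub_cancel, Nat.factorial_succ]
      push_cast
      field_simp
      ring
    simpa only [Finset.sum_range_succ _ (m + 1), mul_add, neg_add, add_sub_cancel] using
      ih.fun_add hlast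

theorem tendsto_exp_neg_mul_sum_pow_div_factorial (m : ℕ) :
    Filter.Tendsto (fun x : ℝ => Real.exp (-x) * ∑ k ∈ Finset.range m, x ^ k / k.factorial)
      Filter.atTop (nhds 0) := by
  have h := tendsto_finsetSum (Finset.range m) fun k _ =>
    (Real.tendsto_pow_mul_exp_neg_atTop_nhds_zero k).div_const (k.factorial : ℝ)
  simp only [zero_div, Finset.sum_const_zero] at h
  refine h.congr fun x => ?_
  rw [Finset.mul_sum]
  exact Finset.sum_congr rfl fun k _ => by ring

/- The Erlang tail: the derivative of the right-hand side telescopes to minus the Gamma density. -/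
theorem gammaMeasure_real_Ici {m : ℕ} (hm : 1 ≤ m) {r x : ℝ} (hr : 0 < r) (hx : 0 ≤ x) :
    (gammaMeasure m r).real (Set.Ici x) =
      Real.exp (-(r * x)) * ∑ k ∈ Finset.range m, (r * x) ^ k / k.factorial := by
  obtain ⟨n, rfl⟩ : ∃ n, m = n + 1 := ⟨m - 1, by omega⟩
  have hderiv : ∀ y ∈ Set.Ici x, HasDerivAt (fun y : ℝ => -(Real.exp (-(r * y)) *
      ∑ k ∈ Finset.range (n + 1), (r * y) ^ k / k.factorial))
      ((r * y) ^ n / n.factorial * Real.exp (-(r * y)) * r) y := fun y _ =>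
    (hasDerivAt_neg_exp_neg_mul_sum_pow_div_factorial n (r * y)).comp y
      (by simpa using (hasDerivAt_id y).const_mul r)
  have hpos : ∀ y ∈ Set.Ioi x, 0 ≤ (r * y) ^ n / n.factorial * Real.exp (-(r * y)) * r :=
    fun y hy => by
      have : 0 < y := hx.trans_lt hy
      positivity
  have hlim := ((tendsto_exp_neg_mul_sum_pow_div_factorial (n + 1)).comp
    (Filter.tendsto_id.const_mul_atTop hr)).neg
  have hint := integral_Ioi_of_hasDerivAt_of_nonneg' hderiv hpos hlim
  rw [neg_zero, zero_sub, neg_neg] at hint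
  rw [← hint, measureReal_def, gammaMeasure_eq_withDensity_restrict_Ici, withDensity_apply _
    measurableSet_Ici, Measure.restrict_restrict measurableSet_Ici, Set.Ici_inter_Ici,
    sup_eq_left.2 hx, ← restrict_Ioi_eq_restrict_Ici, ← integral_toReal (by fun_prop) (by simp)]
  refine setIntegral_congr_fun measurableSet_Ioi fun y hy => ?_
  have hy : 0 < y := hx.trans_lt hy
  have := Real.Gamma_pos_of_pos (Nat.cast_pos.2 n.succ_pos : (0 : ℝ) < (n + 1 : ℕ))
  rw [ENNReal.toReal_ofReal (by positivity), Nat.cast_succ, Real.Gamma_nat_eq_factorial,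
    add_sub_cancel_right, Real.rpow_natCast, ← Nat.cast_succ, Real.rpow_natCast, pow_succ, mul_pow]
  ring

theorem norm_prod_le_pow_card {ι R : Type*} [NormedCommRing R] [NormOneClass R]
    {s : Finset ι} {f : ι → R} {K : ℝ} (hf : ∀ i ∈ s, ‖f i‖ ≤ K) : ‖∏ i ∈ s, f i‖ ≤ K ^ s.card :=
  (s.norm_prod_le f).trans
    ((Finset.prod_le_prod (fun _ _ => norm_nonneg _) hf).trans_eq (Finset.prod_const K))

theorem measurable_comp_finset {Ω β : Type*} [MeasurableSpace Ω] [MeasurableSpace β]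
    {I : Ω → Finset ℕ} (hI : Measurable I) {g : Finset ℕ → Ω → β} (hg : ∀ s, Measurable (g s)) :
    Measurable fun ω => g (I ω) ω :=
  (measurable_from_prod_countable_right (f := fun p : Finset ℕ × Ω => g p.1 p.2) hg).comp
    (hI.prodMk measurable_id)

theorem prod_simpleFunc_comp {ι E M : Type*} [MeasurableSpace E] [CommMonoid M] [DecidableEq M]
    (u : SimpleFunc E M) (s : Finset ι) (x : ι → E) :
    ∏ i ∈ s, u (x i) = ∏ z ∈ u.range, z ^ (s.filter fun i => u (x i) = z).card := by
  rw [← Finset.prod_fiberwise_of_maps_to (t := u.range) fun i _ => u.mem_range_self (x i)]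
  exact Finset.prod_congr rfl fun z _ =>
    Finset.prod_eq_pow_card fun i hi => (Finset.mem_filter.1 hi).2

theorem integral_comp_simpleFunc {E β G : Type*} [MeasurableSpace E] [NormedAddCommGroup G]
    [NormedSpace ℝ G] [CompleteSpace G] (ν : Measure E) [IsFiniteMeasure ν] (u : SimpleFunc E β)
    (g : β → G) : ∫ x, g (u x) ∂ν = ∑ z ∈ u.range, ν.real (u ⁻¹' {z}) • g z := by
  have hsum : ∀ x, g (u x) = ∑ z ∈ u.range, (u ⁻¹' {z}).indicator (fun _ => g z) x := fun x => by
    classical simp [Set.indicator_apply]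
  simp only [hsum]
  rw [integral_finsetSum _ fun z _ => (integrable_const _).indicator (u.measurableSet_fiber z)]
  exact Finset.sum_congr rfl fun z _ => integral_indicator_const _ (u.measurableSet_fiber z)

/-- The random points `Z n`, for `n` in the random finite index set `I`, form a Poisson point
process of intensity `ν`. The process is characterised by its probability generating functional
`u ↦ 𝔼 ∏ u(Z n)`, because this formulation is stable under marking, thinning and mapping. -/
structure IsPoissonProcess {Ω E : Type*} [MeasurableSpace Ω] [MeasurableSpace E]
    (I : Ω → Finset ℕ) (Z : ℕ → Ω → E) (ν : Measure E) (μ : Measure Ω) : Prop where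
  measurable_index : Measurable I
  measurable_point : ∀ n, Measurable (Z n)
  integral_finsetProd : ∀ u : E → ℂ, Measurable u → ∀ K : ℝ, (∀ x, ‖u x‖ ≤ K) →
    ∫ ω, ∏ n ∈ I ω, u (Z n ω) ∂μ = Complex.exp (∫ x, (u x - 1) ∂ν)

section OfCounts

variable {Ω E : Type*} [MeasurableSpace Ω] [MeasurableSpace E] {μ : Measure Ω} {ν : Measure E}
  {I : Ω → Finset ℕ} {Z : ℕ → Ω → E}

theorem integral_pow_of_hasLaw_poissonMeasure {N : Ω → ℕ} {r : NNReal}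
    (hN : HasLaw N (poissonMeasure r) μ) (z : ℂ) :
    ∫ ω, z ^ N ω ∂μ = Complex.exp (r * (z - 1)) := by
  rw [← integral_pow_poissonMeasure, ← hN.map_eq, integral_map hN.aemeasurable (by fun_prop)]

theorem integrable_pow_of_hasLaw_poissonMeasure {N : Ω → ℕ} {r : NNReal}
    (hN : HasLaw N (poissonMeasure r) μ) (z : ℂ) : Integrable (fun ω => z ^ N ω) μ :=
  .of_integral_ne_zero (integral_pow_of_hasLaw_poissonMeasure hN z ▸ Complex.exp_ne_zero _)

variable [IsFiniteMeasure ν]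

open Classical in
theorem integral_prod_simpleFunc_of_counts
    (hcount : ∀ B, MeasurableSet B →
      HasLaw (fun ω => ((I ω).filter fun n => Z n ω ∈ B).card) (poissonMeasure (ν B).toNNReal) μ)
    (hindep : ∀ (k : ℕ) (B : Fin k → Set E), (∀ j, MeasurableSet (B j)) →
      Pairwise (fun i j => Disjoint (B i) (B j)) →
      iIndepFun (fun j ω => ((I ω).filter fun n => Z n ω ∈ B j).card) μ)
    (u : SimpleFunc E ℂ) :
    ∫ ω, ∏ n ∈ I ω, u (Z n ω) ∂μ = Complex.exp (∫ x, (u x - 1) ∂ν) := by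
  let N : ℂ → Ω → ℕ := fun z ω => ((I ω).filter fun n => Z n ω ∈ u ⁻¹' {z}).card
  have hN : ∀ z, HasLaw (N z) (poissonMeasure (ν (u ⁻¹' {z})).toNNReal) μ := fun z =>
    hcount _ (u.measurableSet_fiber z)
  have hfiber : iIndepFun (fun z : u.range => N z) μ := by
    let e := u.range.equivFin
    refine iIndepFun.of_precomp (g := e.symm) e.symm.surjective (hindep _
      (fun j => u ⁻¹' {(e.symm j : ℂ)}) (fun j => u.measurableSet_fiber _) fun i j hij => ?_)
    exact Disjoint.preimage u (Set.disjoint_singleton.2 fun h => hij (e.symm.injective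
      (Subtype.ext h)))
  calc ∫ ω, ∏ n ∈ I ω, u (Z n ω) ∂μ = ∫ ω, ∏ z : u.range, (z : ℂ) ^ N z ω ∂μ :=
        integral_congr_ae (.of_forall fun ω => (prod_simpleFunc_comp u (I ω) _).trans
          (Finset.prod_coe_sort u.range fun z => z ^ N z ω).symm)
    _ = ∏ z : u.range, ∫ ω, (z : ℂ) ^ N z ω ∂μ :=
        hfiber.integral_fun_prod_comp (f := fun (z : u.range) (n : ℕ) => (z : ℂ) ^ n)
          (fun z => (hN z).aemeasurable)
          fun z => (measurable_of_countable _).aestronglyMeasurable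
    _ = ∏ z ∈ u.range, Complex.exp (ν.real (u ⁻¹' {z}) * (z - 1)) := by
        rw [← Finset.prod_coe_sort u.range]
        exact Finset.prod_congr rfl fun z _ => integral_pow_of_hasLaw_poissonMeasure (hN z) z
    _ = Complex.exp (∫ x, (u x - 1) ∂ν) := by
        rw [← Complex.exp_sum, integral_comp_simpleFunc ν u fun z => z - 1]
        simp only [Complex.real_smul]

open Classical in
theorem isPoissonProcess_of_counts (hI : Measurable I) (hZ : ∀ n, Measurable (Z n))
    (hcount : ∀ B, MeasurableSet B →
      HasLaw (fun ω => ((I ω).filter fun n => Z n ω ∈ B).card) (poissonMeasure (ν B).toNNReal) μ)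
    (hindep : ∀ (k : ℕ) (B : Fin k → Set E), (∀ j, MeasurableSet (B j)) →
      Pairwise (fun i j => Disjoint (B i) (B j)) →
      iIndepFun (fun j ω => ((I ω).filter fun n => Z n ω ∈ B j).card) μ) :
    IsPoissonProcess I Z ν μ := by
  refine ⟨hI, hZ, fun u hu K hK => ?_⟩
  have hus := hu.stronglyMeasurable
  let v : ℕ → SimpleFunc E ℂ := hus.approxBounded |K|
  have hvK : ∀ k x, ‖v k x‖ ≤ |K| := fun k x => hus.norm_approxBounded_le (abs_nonneg K) k x
  have hvu : ∀ x, Filter.Tendsto (fun k => v k x) Filter.atTop (nhds (u x)) := fun x =>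
    hus.tendsto_approxBounded_of_norm_le ((hK x).trans (le_abs_self K))
  have hcard : Integrable (fun ω => ((|K| : ℝ) : ℂ) ^ (I ω).card) μ := by
    simpa using integrable_pow_of_hasLaw_poissonMeasure (hcount _ .univ) ((|K| : ℝ) : ℂ)
  have hleft : Filter.Tendsto (fun k => ∫ ω, ∏ n ∈ I ω, v k (Z n ω) ∂μ) Filter.atTop
      (nhds (∫ ω, ∏ n ∈ I ω, u (Z n ω) ∂μ)) := by
    refine tendsto_integral_of_dominated_convergence (fun ω => ‖((|K| : ℝ) : ℂ) ^ (I ω).card‖)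
      (fun k => (measurable_comp_finset hI fun s => s.measurable_fun_prod fun n _ =>
        (v k).measurable.comp (hZ n)).aestronglyMeasurable) hcard.norm
      (fun k => .of_forall fun ω => ?_) (.of_forall fun ω => tendsto_finsetProd _ fun n _ => hvu _)
    simpa using norm_prod_le_pow_card (s := I ω) fun n _ => hvK k (Z n ω)
  have hright : Filter.Tendsto (fun k => ∫ x, (v k x - 1) ∂ν) Filter.atTop
      (nhds (∫ x, (u x - 1) ∂ν)) :=
    tendsto_integral_of_dominated_convergence (fun _ => |K| + 1)
      (fun k => ((v k).measurable.sub_const 1).aestronglyMeasurable) (integrable_const _)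
      (fun k => .of_forall fun x => (norm_sub_le _ _).trans (by simpa using hvK k x))
      (.of_forall fun x => (hvu x).sub_const 1)
  refine tendsto_nhds_unique hleft ?_
  simp only [integral_prod_simpleFunc_of_counts hcount hindep]
  exact (Complex.continuous_exp.tendsto _).comp hright

end OfCounts

theorem integral_prod_of_iIndepFun {Ω T : Type*} [MeasurableSpace Ω] [MeasurableSpace T]
    {μ : Measure Ω} {κ : Measure T} {M : ℕ → Ω → T} (hM : ∀ n, Measurable (M n))
    (hκ : ∀ n, μ.map (M n) = κ) (hind : iIndepFun M μ) (s : Finset ℕ) {f : ℕ → T → ℂ}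
    (hf : ∀ n, Measurable (f n)) :
    ∫ ω, ∏ n ∈ s, f n (M n ω) ∂μ = ∏ n ∈ s, ∫ t, f n t ∂κ := by
  simp only [← Finset.prod_coe_sort s]
  rw [(hind.precomp Subtype.val_injective).integral_fun_prod_comp (f := fun n : s => f n)
    (fun n => (hM n).aemeasurable) fun n => (hf n).aestronglyMeasurable]
  exact Finset.prod_congr rfl fun n _ => by
    rw [← hκ n, integral_map (hM n).aemeasurable (hf n).aestronglyMeasurable]

theorem integral_prod_indep_marks {Ω E T : Type*} [MeasurableSpace Ω] [MeasurableSpace E]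
    [MeasurableSpace T] {μ : Measure Ω} [IsFiniteMeasure μ] {κ : Measure T} [SFinite κ]
    {I : Ω → Finset ℕ} {Z : ℕ → Ω → E} {M : ℕ → Ω → T} (hI : Measurable I)
    (hZ : ∀ n, Measurable (Z n)) (hM : ∀ n, Measurable (M n)) (hκ : ∀ n, μ.map (M n) = κ)
    (hind : iIndepFun M μ)
    (hIZM : IndepFun (fun ω => (I ω, fun n => Z n ω)) (fun ω n => M n ω) μ)
    {u : E × T → ℂ} (hu : Measurable u)
    (hint : Integrable (fun ω => ∏ n ∈ I ω, u (Z n ω, M n ω)) μ) :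
    ∫ ω, ∏ n ∈ I ω, u (Z n ω, M n ω) ∂μ = ∫ ω, ∏ n ∈ I ω, ∫ t, u (Z n ω, t) ∂κ ∂μ := by
  let X : Ω → Finset ℕ × (ℕ → E) := fun ω => (I ω, fun n => Z n ω)
  let Y : Ω → ℕ → T := fun ω n => M n ω
  have hX : Measurable X := hI.prodMk (measurable_pi_iff.2 hZ)
  have hY : Measurable Y := measurable_pi_iff.2 hM
  let g : (Finset ℕ × (ℕ → E)) × (ℕ → T) → ℂ := fun p => ∏ n ∈ p.1.1, u (p.1.2 n, p.2 n)
  have hg : Measurable g := by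
    refine measurable_comp_finset (I := fun p : (Finset ℕ × (ℕ → E)) × (ℕ → T) => p.1.1)
      (g := fun s p => ∏ n ∈ s, u (p.1.2 n, p.2 n)) (by fun_prop) fun s => ?_
    exact s.measurable_fun_prod fun n _ => hu.comp (by fun_prop)
  have hjoint : μ.map (fun ω => (X ω, Y ω)) = (μ.map X).prod (μ.map Y) :=
    (indepFun_iff_map_prod_eq_prod_map_map hX.aemeasurable hY.aemeasurable).1 hIZM
  have hgint : Integrable g ((μ.map X).prod (μ.map Y)) := by
    rwa [← hjoint, integrable_map_measure hg.aestronglyMeasurable (hX.prodMk hY).aemeasurable]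
  have haverage : ∀ x, ∫ y, g (x, y) ∂(μ.map Y) = ∏ n ∈ x.1, ∫ t, u (x.2 n, t) ∂κ := fun x => by
    rw [integral_map (f := fun y => g (x, y)) hY.aemeasurable
      (hg.comp measurable_prodMk_left).aestronglyMeasurable]
    exact integral_prod_of_iIndepFun hM hκ hind x.1 (f := fun n t => u (x.2 n, t)) fun n =>
      hu.comp measurable_prodMk_left
  calc ∫ ω, ∏ n ∈ I ω, u (Z n ω, M n ω) ∂μ = ∫ p, g p ∂((μ.map X).prod (μ.map Y)) := by
        rw [← hjoint, integral_map (hX.prodMk hY).aemeasurable hg.aestronglyMeasurable]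
    _ = ∫ ω, ∫ y, g (X ω, y) ∂(μ.map Y) ∂μ := by
        rw [integral_prod _ hgint, integral_map hX.aemeasurable
          hg.stronglyMeasurable.integral_prod_right'.aestronglyMeasurable]
    _ = ∫ ω, ∏ n ∈ I ω, ∫ t, u (Z n ω, t) ∂κ ∂μ := by simp only [haverage, X]

namespace IsPoissonProcess

variable {Ω E : Type*} [MeasurableSpace Ω] [MeasurableSpace E] {μ : Measure Ω} {ν : Measure E}
  {I : Ω → Finset ℕ} {Z : ℕ → Ω → E}

theorem integrable_pow_card (h : IsPoissonProcess I Z ν μ) (z : ℂ) :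
    Integrable (fun ω => z ^ (I ω).card) μ := by
  refine .of_integral_ne_zero ?_
  simp only [← Finset.prod_const]
  rw [h.integral_finsetProd (fun _ => z) measurable_const ‖z‖ fun _ => le_rfl]
  exact Complex.exp_ne_zero _

theorem isProbabilityMeasure (h : IsPoissonProcess I Z ν μ) : IsProbabilityMeasure μ := by
  have hone := h.integral_finsetProd 1 measurable_one 1 fun _ => by simp
  simp only [Pi.one_apply, Finset.prod_const_one, sub_self, integral_zero, Complex.exp_zero,
    integral_const, Complex.real_smul, mul_one, Complex.ofReal_eq_one] at hone
  exact isProbabilityMeasure_iff_real.2 hone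

theorem integrable_prod (h : IsPoissonProcess I Z ν μ) {u : ℕ → Ω → ℂ}
    (hu : ∀ n, Measurable (u n)) {K : ℝ} (hK : ∀ n ω, ‖u n ω‖ ≤ K) :
    Integrable (fun ω => ∏ n ∈ I ω, u n ω) μ := by
  refine (h.integrable_pow_card K).mono (measurable_comp_finset h.measurable_index fun s =>
    s.measurable_fun_prod fun n _ => hu n).aestronglyMeasurable (.of_forall fun ω => ?_)
  rw [norm_pow, Complex.norm_real]
  exact norm_prod_le_pow_card fun n _ => (hK n ω).trans (le_abs_self K)

theorem marking {T : Type*} [MeasurableSpace T] [IsFiniteMeasure ν] {κ : Measure T}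
    {M : ℕ → Ω → T} (h : IsPoissonProcess I Z ν μ) (hM : ∀ n, Measurable (M n))
    (hκ : ∀ n, μ.map (M n) = κ) (hind : iIndepFun M μ)
    (hIZM : IndepFun (fun ω => (I ω, fun n => Z n ω)) (fun ω n => M n ω) μ) :
    IsPoissonProcess I (fun n ω => (Z n ω, M n ω)) (ν.prod κ) μ := by
  have := h.isProbabilityMeasure
  have : IsProbabilityMeasure κ := hκ 0 ▸ Measure.isProbabilityMeasure_map (hM 0).aemeasurable
  have hZM : ∀ n, Measurable fun ω => (Z n ω, M n ω) := fun n =>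
    (h.measurable_point n).prodMk (hM n)
  refine ⟨h.measurable_index, hZM, fun u hu K hK => ?_⟩
  have hmean : Measurable fun x => ∫ t, u (x, t) ∂κ :=
    (hu.stronglyMeasurable.integral_prod_right' (ν := κ)).measurable
  have hmeanK : ∀ x, ‖∫ t, u (x, t) ∂κ‖ ≤ K := fun x => by
    simpa using norm_integral_le_of_norm_le_const (μ := κ) (.of_forall fun t => hK (x, t))
  have hu1 : Integrable (fun p => u p - 1) (ν.prod κ) :=
    (Integrable.of_bound hu.aestronglyMeasurable K (.of_forall hK)).sub (integrable_const 1)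
  have hux : ∀ x, Integrable (fun t => u (x, t)) κ := fun x =>
    .of_bound (hu.comp measurable_prodMk_left).aestronglyMeasurable K (.of_forall fun t => hK _)
  rw [integral_prod_indep_marks h.measurable_index h.measurable_point hM hκ hind hIZM hu
      (h.integrable_prod (fun n => hu.comp (hZM n)) fun n ω => hK _),
    h.integral_finsetProd (fun x => ∫ t, u (x, t) ∂κ) hmean K hmeanK, integral_prod _ hu1]
  simp only [integral_sub (hux _) (integrable_const 1), integral_const, probReal_univ, one_smul]

theorem thinning (h : IsPoissonProcess I Z ν μ) {D : Set E} [DecidablePred (· ∈ D)]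
    (hD : MeasurableSet D) :
    IsPoissonProcess (fun ω => (I ω).filter fun n => Z n ω ∈ D) Z (ν.restrict D) μ := by
  refine ⟨measurable_finset_iff.2 fun n => ?_, h.measurable_point, fun u hu K hK => ?_⟩
  · simp only [Finset.mem_filter]
    exact ((measurable_finset_mem n).comp h.measurable_index).and
      (measurableSet_setOfPred.1 (h.measurable_point n hD))
  · let v : E → ℂ := fun x => if x ∈ D then u x else 1
    have hv : ∀ x, v x - 1 = D.indicator (fun x => u x - 1) x := fun x => by
      by_cases hx : x ∈ D <;> simp [v, hx]
    have hvK : ∀ x, ‖v x‖ ≤ max K 1 := fun x => by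
      by_cases hx : x ∈ D <;> simp [v, hx, hK]
    simp only [Finset.prod_filter]
    rw [h.integral_finsetProd v (hu.ite hD measurable_const) _ hvK, ← integral_indicator hD]
    simp only [hv]

theorem mapping {G : Type*} [MeasurableSpace G] (h : IsPoissonProcess I Z ν μ) {φ : E → G}
    (hφ : Measurable φ) : IsPoissonProcess I (fun n ω => φ (Z n ω)) (ν.map φ) μ where
  measurable_index := h.measurable_index
  measurable_point n := hφ.comp (h.measurable_point n)
  integral_finsetProd u hu K hK := by
    rw [h.integral_finsetProd (fun x => u (φ x)) (hu.comp hφ) K fun x => hK _,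
      integral_map hφ.aemeasurable (hu.sub_const 1).aestronglyMeasurable]

end IsPoissonProcess

theorem norm_sum_prod_erase_mul_le {ι : Type*} [DecidableEq ι] {s : Finset ι} {f g : ι → ℂ}
    {L : ℝ} (hf : ∀ i, ‖f i‖ ≤ L) (hg : ∀ i, ‖g i‖ ≤ L) :
    ‖∑ i ∈ s, (∏ j ∈ s.erase i, f j) * g i‖ ≤ (2 * L) ^ s.card := by
  have hterm : ∀ i ∈ s, ‖(∏ j ∈ s.erase i, f j) * g i‖ ≤ L ^ s.card := fun i hi => by
    rw [norm_mul, ← Finset.card_erase_add_one hi, pow_succ]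
    have hL : 0 ≤ L := (norm_nonneg _).trans (hf i)
    gcongr
    · exact norm_prod_le_pow_card fun j _ => hf j
    · exact hg i
  rcases s.eq_empty_or_nonempty with rfl | ⟨i, -⟩
  · simp
  have hL : 0 ≤ L := (norm_nonneg _).trans (hf i)
  calc ‖∑ i ∈ s, (∏ j ∈ s.erase i, f j) * g i‖ ≤ s.card * L ^ s.card :=
        (norm_sum_le_of_le s hterm).trans_eq (by rw [Finset.sum_const, nsmul_eq_mul])
    _ ≤ 2 ^ s.card * L ^ s.card := by
        gcongr
        exact_mod_cast Nat.lt_two_pow_self.le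
    _ = (2 * L) ^ s.card := (mul_pow ..).symm

namespace IsPoissonProcess

variable {Ω E : Type*} [MeasurableSpace Ω] [MeasurableSpace E] {μ : Measure Ω} {ν : Measure E}
  {I : Ω → Finset ℕ} {Z : ℕ → Ω → E}

theorem hasDerivAt_integral_prod (h : IsPoissonProcess I Z ν μ) {q v : E → ℂ}
    (hq : Measurable q) (hv : Measurable v) {K : ℝ} (hqK : ∀ x, ‖q x‖ ≤ K)
    (hvK : ∀ x, ‖v x‖ ≤ K) :
    HasDerivAt (fun e : ℂ => ∫ ω, ∏ n ∈ I ω, (q (Z n ω) + e * v (Z n ω)) ∂μ)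
      (∫ ω, ∑ n ∈ I ω, (∏ j ∈ (I ω).erase n, q (Z j ω)) * v (Z n ω) ∂μ) 0 := by
  have hqv : ∀ (e : ℂ) n, Measurable fun ω => q (Z n ω) + e * v (Z n ω) := fun e n =>
    (hq.comp (h.measurable_point n)).add ((hv.comp (h.measurable_point n)).const_mul e)
  have hvL : ∀ x, ‖v x‖ ≤ 2 * |K| := fun x => by
    linarith [hvK x, le_abs_self K, abs_nonneg K]
  have hqvL : ∀ e ∈ Metric.ball (0 : ℂ) 1, ∀ x, ‖q x + e * v x‖ ≤ 2 * |K| := fun e he x => by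
    have he : ‖e‖ ≤ 1 := (mem_ball_zero_iff.1 he).le
    calc ‖q x + e * v x‖ ≤ ‖q x‖ + ‖e‖ * ‖v x‖ := (norm_add_le _ _).trans_eq (by rw [norm_mul])
      _ ≤ |K| + 1 * |K| := by
        gcongr
        · exact (hqK x).trans (le_abs_self K)
        · exact (hvK x).trans (le_abs_self K)
      _ = 2 * |K| := by ring
  simpa only [zero_mul, add_zero] using (hasDerivAt_integral_of_dominated_loc_of_deriv_le
    (F' := fun e ω => ∑ n ∈ I ω,
      (∏ j ∈ (I ω).erase n, (q (Z j ω) + e * v (Z j ω))) * v (Z n ω))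
    (bound := fun ω => ‖((2 * (2 * |K|) : ℝ) : ℂ) ^ (I ω).card‖)
    (Metric.ball_mem_nhds (0 : ℂ) one_pos)
    (.of_forall fun e => (measurable_comp_finset h.measurable_index fun s =>
      s.measurable_fun_prod fun n _ => hqv e n).aestronglyMeasurable)
    (h.integrable_prod (hqv 0) fun n ω => hqvL 0 (by simp) _)
    (measurable_comp_finset h.measurable_index fun s => s.measurable_fun_sum fun n _ =>
      ((s.erase n).measurable_fun_prod fun j _ => hqv 0 j).mul
        (hv.comp (h.measurable_point n))).aestronglyMeasurable
    (.of_forall fun ω e he => by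
      rw [norm_pow, Complex.norm_real, Real.norm_of_nonneg (by positivity)]
      exact norm_sum_prod_erase_mul_le (fun n => hqvL e he _) fun n => hvL _)
    (h.integrable_pow_card _).norm
    (.of_forall fun ω e _ => by
      simpa only [smul_eq_mul] using HasDerivAt.fun_finsetProd (u := I ω)
        fun n _ => (hasDerivAt_mul_const (x := e) (v (Z n ω))).const_add (q (Z n ω)))).2

/- Differentiate the generating functional at `q` in the direction `v`. -/
theorem integral_sum_prod_erase_mul [IsFiniteMeasure ν] (h : IsPoissonProcess I Z ν μ)
    {q v : E → ℂ} (hq : Measurable q) (hv : Measurable v) {K : ℝ} (hqK : ∀ x, ‖q x‖ ≤ K)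
    (hvK : ∀ x, ‖v x‖ ≤ K) :
    ∫ ω, ∑ n ∈ I ω, (∏ j ∈ (I ω).erase n, q (Z j ω)) * v (Z n ω) ∂μ =
      (∫ x, v x ∂ν) * Complex.exp (∫ x, (q x - 1) ∂ν) := by
  have hvint : Integrable v ν := .of_bound hv.aestronglyMeasurable K (.of_forall hvK)
  have hqint : Integrable (fun x => q x - 1) ν :=
    (Integrable.of_bound hq.aestronglyMeasurable K (.of_forall hqK)).sub (integrable_const 1)
  have hpgfl : ∀ e : ℂ, ∫ ω, ∏ n ∈ I ω, (q (Z n ω) + e * v (Z n ω)) ∂μ =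
      Complex.exp (∫ x, (q x - 1) ∂ν + e * ∫ x, v x ∂ν) := fun e => by
    rw [h.integral_finsetProd (fun x => q x + e * v x) (hq.add (hv.const_mul e)) (K + ‖e‖ * K)
      fun x => ?_, ← integral_const_mul, ← integral_add hqint (hvint.const_mul e)]
    · congr 2 with x
      ring
    · refine (norm_add_le _ _).trans ?_
      rw [norm_mul]
      gcongr
      · exact hqK x
      · exact hvK x
  have hderiv := h.hasDerivAt_integral_prod hq hv hqK hvK
  simp only [hpgfl] at hderiv
  refine hderiv.unique ((((hasDerivAt_mul_const (x := (0 : ℂ)) (∫ x, v x ∂ν)).const_add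
    (∫ x, (q x - 1) ∂ν)).cexp).congr_deriv ?_)
  rw [zero_mul, add_zero, mul_comm]

end IsPoissonProcess

section IndexMeasure

theorem indicator_mem_index {Ω β : Type*} [Zero β] (I : Ω → Finset ℕ)
    (f : Ω × ℕ → β) (ω : Ω) (n : ℕ) :
    {p : Ω × ℕ | p.2 ∈ I p.1}.indicator f (ω, n) =
      (I ω : Set ℕ).indicator (fun n => f (ω, n)) n := by
  simp [Set.indicator]

variable {Ω : Type*} [MeasurableSpace Ω] {μ : Measure Ω} {I : Ω → Finset ℕ}

/-- The measure on pairs `(ω, n)` which counts the indices `n ∈ I ω` and integrates over `ω`: its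
integrals are the expectations of the sums over the random index set `I`. -/
noncomputable def indexMeasure (μ : Measure Ω) (I : Ω → Finset ℕ) : Measure (Ω × ℕ) :=
  (μ.prod Measure.count).restrict {p | p.2 ∈ I p.1}

theorem measurableSet_mem_index (hI : Measurable I) : MeasurableSet {p : Ω × ℕ | p.2 ∈ I p.1} :=
  measurableSet_setOfPred.2 (measurable_from_prod_countable_left fun n =>
    (measurable_finset_mem n).comp hI)

theorem lintegral_indexMeasure [SFinite μ] (hI : Measurable I) {f : Ω × ℕ → ENNReal}
    (hf : Measurable f) : ∫⁻ p, f p ∂(indexMeasure μ I) = ∫⁻ ω, ∑ n ∈ I ω, f (ω, n) ∂μ := by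
  have hN := measurableSet_mem_index hI
  rw [indexMeasure, ← lintegral_indicator hN, lintegral_prod _ (hf.indicator hN).aemeasurable]
  refine lintegral_congr fun ω => ?_
  simp only [indicator_mem_index]
  rw [lintegral_indicator (I ω).measurableSet, lintegral_finset]
  simp

theorem integral_indexMeasure [SFinite μ] (hI : Measurable I) {f : Ω × ℕ → ℂ}
    (hf : Integrable f (indexMeasure μ I)) :
    ∫ p, f p ∂(indexMeasure μ I) = ∫ ω, ∑ n ∈ I ω, f (ω, n) ∂μ := by
  have hN := measurableSet_mem_index hI
  rw [indexMeasure, ← integral_indicator hN, integral_prod _ ((integrable_indicator_iff hN).2 hf)]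
  refine integral_congr_ae (.of_forall fun ω => ?_)
  simp only [indicator_mem_index]
  rw [integral_indicator (I ω).measurableSet, setIntegral_finset]
  · simp [measureReal_def]
  · refine ⟨(measurable_of_countable _).aestronglyMeasurable, ?_⟩
    rw [HasFiniteIntegral, lintegral_finset]
    simp [ENNReal.sum_lt_top]

end IndexMeasure

section ShotNoise

variable {Ω E : Type*} {I : Ω → Finset ℕ} {Z : ℕ → Ω → E} {w : E → ℝ}

/-- The shot noise of a point process: the sum of the weights of its points. -/
def shotNoise (I : Ω → Finset ℕ) (Z : ℕ → Ω → E) (w : E → ℝ) (ω : Ω) : ℝ :=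
  ∑ n ∈ I ω, w (Z n ω)

/-- The shot noise of the points other than the point of index `n`. -/
def reducedShotNoise (I : Ω → Finset ℕ) (Z : ℕ → Ω → E) (w : E → ℝ) (n : ℕ) (ω : Ω) : ℝ :=
  ∑ j ∈ (I ω).erase n, w (Z j ω)

variable [MeasurableSpace Ω] [MeasurableSpace E] {μ : Measure Ω} {ν : Measure E}

namespace IsPoissonProcess

theorem measurable_shotNoise (h : IsPoissonProcess I Z ν μ) (hw : Measurable w) :
    Measurable (shotNoise I Z w) :=
  measurable_comp_finset h.measurable_index fun s =>
    s.measurable_fun_sum fun n _ => hw.comp (h.measurable_point n)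

theorem measurable_reducedShotNoise (h : IsPoissonProcess I Z ν μ) (hw : Measurable w) :
    Measurable fun p : Ω × ℕ => reducedShotNoise I Z w p.2 p.1 :=
  measurable_from_prod_countable_left fun n => measurable_comp_finset h.measurable_index fun s =>
    (s.erase n).measurable_fun_sum fun j _ => hw.comp (h.measurable_point j)

theorem measurable_uncurry_point (h : IsPoissonProcess I Z ν μ) :
    Measurable fun p : Ω × ℕ => Z p.2 p.1 :=
  measurable_from_prod_countable_left h.measurable_point

theorem isFiniteMeasure_indexMeasure [IsFiniteMeasure ν] (h : IsPoissonProcess I Z ν μ) :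
    IsFiniteMeasure (indexMeasure μ I) := by
  have := h.isProbabilityMeasure
  refine ⟨?_⟩
  rw [← lintegral_one, lintegral_indexMeasure h.measurable_index measurable_const]
  refine lt_of_le_of_lt (lintegral_mono fun ω => ?_) (h.integrable_pow_card 2).2
  have htwo : ‖(2 : ℂ)‖ₑ = 2 := by
    rw [← ofReal_norm]
    norm_num
  rw [Finset.sum_const, nsmul_one, enorm_pow, htwo]
  exact_mod_cast Nat.cast_le.2 Nat.lt_two_pow_self.le

theorem integral_sum_charFun_reducedShotNoise [IsFiniteMeasure ν] (h : IsPoissonProcess I Z ν μ)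
    (hw : Measurable w) {B : Set E} (hB : MeasurableSet B) (t : ℝ) :
    ∫ ω, ∑ n ∈ I ω, Complex.exp (t * reducedShotNoise I Z w n ω * Complex.I) *
        B.indicator 1 (Z n ω) ∂μ =
      ν.real B * ∫ ω, Complex.exp (t * shotNoise I Z w ω * Complex.I) ∂μ := by
  have hexp : ∀ (s : Finset ℕ) ω, Complex.exp (t * ((∑ j ∈ s, w (Z j ω) : ℝ) : ℂ) * Complex.I) =
      ∏ j ∈ s, Complex.exp (t * w (Z j ω) * Complex.I) := fun s ω => by
    rw [← Complex.exp_sum, Complex.ofReal_sum, Finset.mul_sum, Finset.sum_mul]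
  have hq : Measurable fun x => Complex.exp (t * w x * Complex.I) := by fun_prop
  have hqb : ∀ x, ‖Complex.exp (t * w x * Complex.I)‖ ≤ 1 := fun x => by
    rw [← Complex.ofReal_mul, Complex.norm_exp_ofReal_mul_I]
  have hvb : ∀ x, ‖B.indicator (1 : E → ℂ) x‖ ≤ 1 := fun x =>
    (norm_indicator_le_norm_self _ _).trans (by simp)
  simp only [shotNoise, reducedShotNoise, hexp]
  rw [h.integral_finsetProd _ hq 1 hqb,
    h.integral_sum_prod_erase_mul hq (measurable_one.indicator hB) hqb hvb, integral_indicator hB,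
    Pi.one_def, setIntegral_const, Complex.real_smul, mul_one]

theorem map_reducedShotNoise_restrict [IsFiniteMeasure ν] (h : IsPoissonProcess I Z ν μ)
    (hw : Measurable w) {B : Set E} (hB : MeasurableSet B) :
    ((indexMeasure μ I).restrict {p | Z p.2 p.1 ∈ B}).map
      (fun p => reducedShotNoise I Z w p.2 p.1) = ν B • μ.map (shotNoise I Z w) := by
  have := h.isProbabilityMeasure
  have := h.isFiniteMeasure_indexMeasure
  have : IsFiniteMeasure (ν B • μ.map (shotNoise I Z w)) :=
    Measure.smul_finite _ (measure_ne_top ν B)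
  refine Measure.ext_of_charFun (funext fun t => ?_)
  have hexp : Measurable fun y : ℝ => Complex.exp (t * y * Complex.I) := by fun_prop
  have hB' : MeasurableSet {p : Ω × ℕ | Z p.2 p.1 ∈ B} := h.measurable_uncurry_point hB
  have hred := h.measurable_reducedShotNoise hw
  have hint : Integrable ({p : Ω × ℕ | Z p.2 p.1 ∈ B}.indicator fun p =>
      Complex.exp (t * reducedShotNoise I Z w p.2 p.1 * Complex.I)) (indexMeasure μ I) :=
    .of_bound ((hexp.comp hred).indicator hB').aestronglyMeasurable 1 (.of_forall fun p => by
      refine (norm_indicator_le_norm_self _ _).trans ?_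
      rw [← Complex.ofReal_mul, Complex.norm_exp_ofReal_mul_I])
  rw [charFun_apply_real, charFun_apply_real, integral_smul_measure,
    integral_map hred.aemeasurable hexp.aestronglyMeasurable,
    integral_map (h.measurable_shotNoise hw).aemeasurable hexp.aestronglyMeasurable,
    ← integral_indicator hB', integral_indexMeasure h.measurable_index hint, Complex.real_smul]
  refine (integral_congr_ae (.of_forall fun ω => Finset.sum_congr rfl fun n _ => ?_)).trans
    (h.integral_sum_charFun_reducedShotNoise hw hB t)
  simp only [Set.indicator, Pi.one_apply, mul_ite, mul_one, mul_zero]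
  rfl

theorem slivnyak_mecke [IsFiniteMeasure ν] (h : IsPoissonProcess I Z ν μ) (hw : Measurable w) :
    (indexMeasure μ I).map (fun p => (Z p.2 p.1, reducedShotNoise I Z w p.2 p.1)) =
      ν.prod (μ.map (shotNoise I Z w)) := by
  have := h.isProbabilityMeasure
  have hred := h.measurable_reducedShotNoise hw
  refine (Measure.prod_eq fun B C hB hC => ?_).symm
  have hr := congrArg (fun m => m C) (h.map_reducedShotNoise_restrict hw hB)
  simp only [Measure.smul_apply, smul_eq_mul] at hr
  rw [← hr, Measure.map_apply hred hC, Measure.restrict_apply (hred hC),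
    Measure.map_apply (h.measurable_uncurry_point.prodMk hred) (hB.prod hC)]
  congr 1 with p
  simp [and_comm]

theorem map_point_indexMeasure [IsFiniteMeasure ν] (h : IsPoissonProcess I Z ν μ) :
    (indexMeasure μ I).map (fun p => Z p.2 p.1) = ν := by
  have := h.isProbabilityMeasure
  have hw : Measurable (0 : E → ℝ) := measurable_zero
  have := Measure.isProbabilityMeasure_map (μ := μ) (h.measurable_shotNoise hw).aemeasurable
  rw [← Measure.fst_prod (μ := ν) (ν := μ.map (shotNoise I Z 0)), ← h.slivnyak_mecke hw,
    Measure.fst_map_prodMk (h.measurable_reducedShotNoise hw)]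

theorem ae_forall_mem [IsFiniteMeasure ν] (h : IsPoissonProcess I Z ν μ) {B : Set E}
    (hB : MeasurableSet B) (hν : ∀ᵐ x ∂ν, x ∈ B) : ∀ᵐ ω ∂μ, ∀ n ∈ I ω, Z n ω ∈ B := by
  have := h.isProbabilityMeasure
  have hone : Measurable (Bᶜ.indicator (1 : E → ENNReal)) := measurable_one.indicator hB.compl
  have hzero : ∫⁻ ω, ∑ n ∈ I ω, Bᶜ.indicator (1 : E → ENNReal) (Z n ω) ∂μ = 0 := by
    rw [← lintegral_indexMeasure (f := fun p => Bᶜ.indicator 1 (Z p.2 p.1)) h.measurable_index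
      (hone.comp h.measurable_uncurry_point), ← lintegral_map hone h.measurable_uncurry_point,
      h.map_point_indexMeasure, lintegral_indicator_one hB.compl]
    exact hν
  have hsum : Measurable fun ω => ∑ n ∈ I ω, Bᶜ.indicator (1 : E → ENNReal) (Z n ω) :=
    measurable_comp_finset h.measurable_index fun s =>
      s.measurable_fun_sum fun n _ => hone.comp (h.measurable_point n)
  filter_upwards [(lintegral_eq_zero_iff hsum).1 hzero] with ω hω n hn
  simpa using Finset.sum_eq_zero_iff.1 hω n hn

theorem integral_exp_neg_mul_shotNoise [IsFiniteMeasure ν] (h : IsPoissonProcess I Z ν μ)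
    (hw : Measurable w) (hw0 : ∀ᵐ x ∂ν, 0 ≤ w x) {s : ℝ} (hs : 0 ≤ s) :
    ∫ ω, Real.exp (-s * shotNoise I Z w ω) ∂μ =
      Real.exp (∫ x, (Real.exp (-s * w x) - 1) ∂ν) := by
  let u : E → ℝ := fun x => Real.exp (-s * max (w x) 0)
  have hu : Measurable u := by fun_prop
  have hu1 : ∀ x, ‖(u x : ℂ)‖ ≤ 1 := fun x => by
    rw [Complex.norm_real, Real.norm_of_nonneg (Real.exp_nonneg _), Real.exp_le_one_iff]
    exact mul_nonpos_of_nonpos_of_nonneg (neg_nonpos.2 hs) (le_max_right _ _)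
  have hlhs : ∀ᵐ ω ∂μ, Real.exp (-s * shotNoise I Z w ω) = ∏ n ∈ I ω, u (Z n ω) := by
    filter_upwards [h.ae_forall_mem (measurableSet_le measurable_const hw) hw0] with ω hω
    rw [shotNoise, Finset.mul_sum, Real.exp_sum]
    exact Finset.prod_congr rfl fun n hn => by rw [← max_eq_left (hω n hn)]
  have hrhs : ∀ᵐ x ∂ν, Real.exp (-s * w x) - 1 = u x - 1 := by
    filter_upwards [hw0] with x hx
    rw [← max_eq_left hx]
  rw [integral_congr_ae hlhs, integral_congr_ae hrhs]
  have hpgfl := h.integral_finsetProd (fun x => (u x : ℂ)) (by fun_prop) 1 hu1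
  exact_mod_cast hpgfl

end IsPoissonProcess

end ShotNoise

namespace IsPoissonProcess

variable {Ω E : Type*} [MeasurableSpace Ω] [MeasurableSpace E] {μ : Measure Ω} {ν : Measure E}
  {I : Ω → Finset ℕ} {Z : ℕ → Ω → E} {w : E → ℝ} {D : Set (E × ℝ)}
  [DecidablePred (· ∈ D)]

theorem measurable_card_filter_reducedShotNoise (h : IsPoissonProcess I Z ν μ)
    (hw : Measurable w) (hD : MeasurableSet D) :
    Measurable fun ω => ((I ω).filter fun n => (Z n ω, reducedShotNoise I Z w n ω) ∈ D).card := by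
  have hpt : ∀ n, Measurable fun ω => (Z n ω, reducedShotNoise I Z w n ω) := fun n =>
    (h.measurable_point n).prodMk ((h.measurable_reducedShotNoise hw).comp measurable_prodMk_right)
  have hind : ∀ n, Measurable fun ω =>
      if (Z n ω, reducedShotNoise I Z w n ω) ∈ D then (1 : ℕ) else 0 := fun n =>
    Measurable.ite (hpt n hD) measurable_const measurable_const
  simp only [Finset.card_filter]
  exact measurable_comp_finset (g := fun s ω => ∑ n ∈ s,
    if (Z n ω, reducedShotNoise I Z w n ω) ∈ D then 1 else 0) h.measurable_index fun s =>
    s.measurable_fun_sum fun n _ => hind n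

variable [IsFiniteMeasure ν]

theorem lintegral_card_filter_reducedShotNoise (h : IsPoissonProcess I Z ν μ)
    (hw : Measurable w) (hD : MeasurableSet D) :
    ∫⁻ ω, (((I ω).filter fun n => (Z n ω, reducedShotNoise I Z w n ω) ∈ D).card : ENNReal) ∂μ =
      ν.prod (μ.map (shotNoise I Z w)) D := by
  have := h.isProbabilityMeasure
  have hpt := h.measurable_uncurry_point.prodMk (h.measurable_reducedShotNoise hw)
  have hone : Measurable (D.indicator (1 : E × ℝ → ENNReal)) := measurable_one.indicator hD
  rw [← h.slivnyak_mecke hw, ← lintegral_indicator_one hD, lintegral_map hone hpt]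
  refine Eq.trans ?_ (lintegral_indexMeasure h.measurable_index (hone.comp hpt)).symm
  simp only [Finset.card_filter, Nat.cast_sum]
  congr! with ω n
  by_cases hn : (Z n ω, reducedShotNoise I Z w n ω) ∈ D <;> simp [hn]

theorem integrable_card_filter_reducedShotNoise (h : IsPoissonProcess I Z ν μ)
    (hw : Measurable w) (hD : MeasurableSet D) :
    Integrable (fun ω =>
      (((I ω).filter fun n => (Z n ω, reducedShotNoise I Z w n ω) ∈ D).card : ℝ)) μ := by
  have := h.isProbabilityMeasure
  refine ⟨(measurable_from_top.comp
    (h.measurable_card_filter_reducedShotNoise hw hD)).aestronglyMeasurable, ?_⟩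
  simp only [HasFiniteIntegral, Real.enorm_natCast]
  rw [h.lintegral_card_filter_reducedShotNoise hw hD]
  exact measure_lt_top _ _

theorem integral_card_filter_reducedShotNoise (h : IsPoissonProcess I Z ν μ)
    (hw : Measurable w) (hD : MeasurableSet D) :
    ∫ ω, (((I ω).filter fun n => (Z n ω, reducedShotNoise I Z w n ω) ∈ D).card : ℝ) ∂μ =
      (ν.prod (μ.map (shotNoise I Z w))).real D := by
  rw [measureReal_def, ← h.lintegral_card_filter_reducedShotNoise hw hD,
    integral_eq_lintegral_of_nonneg_ae (.of_forall fun ω => Nat.cast_nonneg _)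
      (h.integrable_card_filter_reducedShotNoise hw hD).aestronglyMeasurable]
  simp only [ENNReal.ofReal_natCast]

end IsPoissonProcess

theorem measureReal_prod_prod_setOf_le {E : Type*} [MeasurableSpace E] {ν : Measure E}
    {γ Q : Measure ℝ} [IsFiniteMeasure ν] [IsFiniteMeasure γ] [IsFiniteMeasure Q]
    {ψ : E × ℝ → ℝ} (hψ : Measurable ψ) :
    ((ν.prod γ).prod Q).real {p | ψ (p.1.1, p.2) ≤ p.1.2} =
      ∫ x, ∫ y, γ.real (Set.Ici (ψ (x, y))) ∂Q ∂ν := by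
  let D : Set ((E × ℝ) × ℝ) := {p | ψ (p.1.1, p.2) ≤ p.1.2}
  have hD : MeasurableSet D := measurableSet_le (by fun_prop) (by fun_prop)
  have hone : Integrable (D.indicator (1 : (E × ℝ) × ℝ → ℝ)) ((ν.prod γ).prod Q) :=
    (integrable_const 1).indicator hD
  rw [← integral_indicator_one hD, integral_prod _ hone, integral_prod _ hone.integral_prod_left]
  refine integral_congr_ae (.of_forall fun x => ?_)
  have hmeas : Measurable fun q : ℝ × ℝ => D.indicator (1 : (E × ℝ) × ℝ → ℝ) ((x, q.1), q.2) :=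
    (measurable_one.indicator hD).comp (by fun_prop)
  simp only
  rw [integral_integral_swap (.of_bound hmeas.aestronglyMeasurable 1 (.of_forall fun q =>
    (norm_indicator_le_norm_self _ _).trans (by simp)))]
  refine integral_congr_ae (.of_forall fun y => ?_)
  simp only
  rw [← integral_indicator_one measurableSet_Ici]
  rfl

section Laplace

variable {Q : Measure ℝ} [IsFiniteMeasure Q] {L : ℝ → ℝ} {s : ℝ}

theorem neg_mem_interior_integrableExpSet (hQ : ∀ᵐ y ∂Q, 0 ≤ y) (hs : 0 < s) :
    -s ∈ interior (integrableExpSet id Q) := by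
  have hsub : Set.Iic (0 : ℝ) ⊆ integrableExpSet id Q := fun t ht => by
    refine Integrable.of_bound (by fun_prop) 1 ?_
    filter_upwards [hQ] with y hy
    rw [Real.norm_of_nonneg (Real.exp_nonneg _), Real.exp_le_one_iff]
    exact mul_nonpos_of_nonpos_of_nonneg ht hy
  refine interior_mono hsub ?_
  rw [interior_Iic]
  exact neg_lt_zero.2 hs

theorem iteratedDeriv_of_eq_laplace (hQ : ∀ᵐ y ∂Q, 0 ≤ y)
    (hL : ∀ s, 0 ≤ s → ∫ y, Real.exp (-s * y) ∂Q = L s) (hs : 0 < s) (k : ℕ) :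
    iteratedDeriv k L s = (-1) ^ k * ∫ y, y ^ k * Real.exp (-s * y) ∂Q := by
  have hmgf : L =ᶠ[nhds s] fun s => mgf id Q (-s) := by
    filter_upwards [Ioi_mem_nhds hs] with t ht
    exact (hL t (le_of_lt ht)).symm
  rw [hmgf.iteratedDeriv_eq, iteratedDeriv_comp_neg,
    iteratedDeriv_mgf (neg_mem_interior_integrableExpSet hQ hs)]
  rfl

theorem integral_exp_neg_mul_sum_pow_div_factorial (hQ : ∀ᵐ y ∂Q, 0 ≤ y)
    (hL : ∀ s, 0 ≤ s → ∫ y, Real.exp (-s * y) ∂Q = L s) (hs : 0 < s) (m : ℕ) :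
    ∫ y, Real.exp (-(s * y)) * ∑ k ∈ Finset.range m, (s * y) ^ k / k.factorial ∂Q =
      ∑ k ∈ Finset.range m, (-s) ^ k / k.factorial * iteratedDeriv k L s := by
  have hexpand : ∀ y : ℝ, Real.exp (-(s * y)) * ∑ k ∈ Finset.range m, (s * y) ^ k / k.factorial =
      ∑ k ∈ Finset.range m, s ^ k / k.factorial * (y ^ k * Real.exp (-s * y)) := fun y => by
    rw [Finset.mul_sum]
    refine Finset.sum_congr rfl fun k _ => ?_
    rw [mul_pow, neg_mul]
    ring
  have hint : ∀ k : ℕ, Integrable (fun y => y ^ k * Real.exp (-s * y)) Q :=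
    integrable_pow_mul_exp_of_mem_interior_integrableExpSet
      (neg_mem_interior_integrableExpSet hQ hs)
  simp only [hexpand]
  rw [integral_finsetSum _ fun k _ => (hint k).const_mul _]
  refine Finset.sum_congr rfl fun k _ => ?_
  rw [integral_const_mul, iteratedDeriv_of_eq_laplace hQ hL hs, ← mul_assoc,
    div_mul_eq_mul_div _ _ ((-1 : ℝ) ^ k), ← mul_pow, mul_neg_one, neg_neg]

theorem integral_gammaMeasure_real_Ici (hQ : ∀ᵐ y ∂Q, 0 ≤ y)
    (hL : ∀ s, 0 ≤ s → ∫ y, Real.exp (-s * y) ∂Q = L s) {m : ℕ} (hm : 1 ≤ m) {r t : ℝ}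
    (hr : 0 < r) (ht : 0 < t) :
    ∫ y, (gammaMeasure m r).real (Set.Ici (t * y)) ∂Q =
      ∑ k ∈ Finset.range m, (-(r * t)) ^ k / k.factorial * iteratedDeriv k L (r * t) := by
  rw [← integral_exp_neg_mul_sum_pow_div_factorial hQ hL (mul_pos hr ht)]
  refine integral_congr_ae ?_
  filter_upwards [hQ] with y hy
  rw [gammaMeasure_real_Ici hm hr (by positivity), mul_assoc]

end Laplace

section PolarCoordinates

theorem strictMonoOn_sqrt_sq_add (b : ℝ) :
    StrictMonoOn (fun ρ : ℝ => Real.sqrt (ρ ^ 2 + b ^ 2)) (Set.Ici 0) := fun x hx y _ hxy => by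
  have hx : 0 ≤ x := hx
  exact Real.sqrt_lt_sqrt (by positivity) (by gcongr)

theorem integral_mul_comp_sqrt_sq_add_sq {h R : ℝ} (hh : 0 < h) (hR : 0 ≤ R) (f : ℝ → ℝ) :
    ∫ ρ in (0)..R, ρ * f (Real.sqrt (ρ ^ 2 + h ^ 2)) =
      ∫ r in h..Real.sqrt (h ^ 2 + R ^ 2), f r * r := by
  have hmono := (strictMonoOn_sqrt_sq_add h).mono
    (Set.Icc_subset_Ici_self : Set.Icc 0 R ⊆ Set.Ici 0)
  have hpos : ∀ ρ : ℝ, 0 < Real.sqrt (ρ ^ 2 + h ^ 2) := fun ρ => by positivity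
  have himage : (fun ρ : ℝ => Real.sqrt (ρ ^ 2 + h ^ 2)) '' Set.Icc 0 R =
      Set.Icc h (Real.sqrt (h ^ 2 + R ^ 2)) := by
    rw [ContinuousOn.image_Icc_of_monotoneOn hR (by fun_prop) hmono.monotoneOn,
      zero_pow two_ne_zero, zero_add, Real.sqrt_sq hh.le, add_comm]
  have hderiv : ∀ ρ ∈ Set.Icc (0 : ℝ) R, HasDerivWithinAt
      (fun ρ : ℝ => Real.sqrt (ρ ^ 2 + h ^ 2)) (ρ / Real.sqrt (ρ ^ 2 + h ^ 2)) (Set.Icc 0 R) ρ :=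
    fun ρ _ => (((hasDerivAt_pow 2 ρ).add_const (h ^ 2)).sqrt (by positivity)).congr_deriv (by
      field_simp [(hpos ρ).ne']
      simp) |>.hasDerivWithinAt
  rw [intervalIntegral.integral_of_le hR,
    intervalIntegral.integral_of_le (Real.le_sqrt_of_sq_le (by nlinarith)),
    ← integral_Icc_eq_integral_Ioc, ← integral_Icc_eq_integral_Ioc, ← himage,
    integral_image_eq_integral_abs_deriv_smul measurableSet_Icc hderiv hmono.injOn]
  refine setIntegral_congr_fun measurableSet_Icc fun ρ hρ => ?_
  have hsqrt := hpos ρ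
  simp only [smul_eq_mul]
  rw [abs_of_nonneg (div_nonneg hρ.1 hsqrt.le)]
  field_simp

theorem setIntegral_closedBall_comp_norm_sub (c : Plane) {R : ℝ} (hR : 0 ≤ R) (f : ℝ → ℝ) :
    ∫ x in Metric.closedBall c R, f ‖x - c‖ = 2 * Real.pi * ∫ ρ in (0)..R, ρ * f ρ := by
  have hradial : ∫ x in Metric.closedBall c R, f ‖x - c‖ =
      ∫ x : Plane, (Set.Iic R).indicator f ‖x‖ := by
    rw [← integral_indicator measurableSet_closedBall,
      ← integral_sub_right_eq_self (fun x : Plane => (Set.Iic R).indicator f ‖x‖) c]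
    refine integral_congr_ae (.of_forall fun x => ?_)
    simp [Set.indicator, dist_eq_norm]
  have hvol : volume.real (Metric.ball (0 : Plane) 1) = Real.pi := by
    rw [measureReal_def, EuclideanSpace.volume_ball_fin_two]
    simp [Real.pi_nonneg]
  rw [hradial, integral_fun_norm_addHaar volume, hvol, finrank_euclideanSpace_fin,
    intervalIntegral.integral_of_le hR, ← Set.Ioi_inter_Iic,
    ← setIntegral_indicator measurableSet_Iic, nsmul_eq_mul, smul_eq_mul, ← mul_assoc]
  refine congrArg (2 * Real.pi * ·) (integral_congr_ae (.of_forall fun ρ => ?_))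
  by_cases hρ : ρ ≤ R <;> simp [hρ]

theorem setIntegral_coverage_comp_droneDist (c : Plane) {h R : ℝ} (hh : 0 < h) (hR : 0 ≤ R)
    (f : ℝ → ℝ) :
    ∫ x in NodeField.coverage c R, f (NodeField.droneDist c h x) =
      2 * Real.pi * ∫ r in h..Real.sqrt (h ^ 2 + R ^ 2), f r * r := by
  rw [← integral_mul_comp_sqrt_sq_add_sq hh hR]
  exact setIntegral_closedBall_comp_norm_sub c hR fun ρ => f (Real.sqrt (ρ ^ 2 + h ^ 2))

end PolarCoordinates

theorem ext_of_singleton_true {τ₁ τ₂ : Measure Bool} [IsProbabilityMeasure τ₁]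
    [IsProbabilityMeasure τ₂] (h : τ₁ {true} = τ₂ {true}) : τ₁ = τ₂ := by
  have hfalse : ({false} : Set Bool) = {true}ᶜ := by
    ext b
    cases b <;> simp
  refine Measure.ext_of_singleton fun b => ?_
  cases b
  · rw [hfalse, prob_compl_eq_one_sub (measurableSet_singleton _),
      prob_compl_eq_one_sub (measurableSet_singleton _), h]
  · exact h

theorem map_restrict_prod_prod {E T G : Type*} [MeasurableSpace E] [MeasurableSpace T]
    [MeasurableSpace G] {ν : Measure E} {τ : Measure T} {γ : Measure G} [IsFiniteMeasure ν]
    [IsFiniteMeasure τ] [IsFiniteMeasure γ] (D : Set T) :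
    ((ν.prod (τ.prod γ)).restrict {p | p.2.1 ∈ D}).map (fun p => (p.1, p.2.2)) =
      ((τ D).toNNReal • ν).prod γ := by
  refine (Measure.prod_eq fun s t hs ht => ?_).symm
  have hrect : (fun p : E × T × G => (p.1, p.2.2)) ⁻¹' s ×ˢ t ∩ {p | p.2.1 ∈ D} =
      s ×ˢ D ×ˢ t := by
    ext p
    simp only [Set.mem_inter_iff, Set.mem_preimage, Set.mem_prod, Set.mem_ofPred_eq]
    tauto
  rw [Measure.map_apply (by fun_prop) (hs.prod ht),
    Measure.restrict_apply ((hs.prod ht).preimage (by fun_prop)), hrect, Measure.prod_prod,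
    Measure.prod_prod, Measure.smul_apply, ENNReal.smul_def,
    ENNReal.coe_toNNReal (measure_ne_top τ D), smul_eq_mul]
  ring

namespace NodeField

variable {Ω : Type*} {F : NodeField Ω} {S : Set Plane}

/-- Position and gain of a node. -/
def posGain (F : NodeField Ω) (n : ℕ) (ω : Ω) : Plane × ℝ := (F.pos n ω, F.gain n ω)

open Classical in
theorem card_filter_nodes_eq_count (F : NodeField Ω) (S B : Set Plane) (ω : Ω) :
    (((Finset.range (F.card ω)).filter fun n => F.pos n ω ∈ S).filter
      fun n => F.pos n ω ∈ B).card = F.count (B ∩ S) ω := by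
  simp only [count, Finset.filter_filter, Set.mem_inter_iff, and_comm]

variable [MeasurableSpace Ω] {μ : Measure Ω} {A : Set Plane} {lam a : ℝ} {m : ℕ}

open Classical in
theorem IsHomogeneousPPP.isPoissonProcess (hF : F.IsHomogeneousPPP μ A lam) (hlam : 0 ≤ lam)
    (hS : MeasurableSet S) (hSA : S ⊆ A) [IsFiniteMeasure (volume.restrict S)] :
    IsPoissonProcess (fun ω => (Finset.range (F.card ω)).filter fun n => F.pos n ω ∈ S) F.pos
      (lam.toNNReal • volume.restrict S) μ := by
  have hmean : ∀ B, MeasurableSet B → ((lam.toNNReal • volume.restrict S) B).toNNReal =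
      (lam * volume.real (B ∩ S)).toNNReal := fun B hB => by
    rw [Measure.smul_apply, Measure.restrict_apply hB, Real.toNNReal_mul hlam, ENNReal.smul_def,
      smul_eq_mul, ENNReal.toNNReal_mul, ENNReal.toNNReal_coe, measureReal_def]
    simp [ENNReal.toReal]
  refine isPoissonProcess_of_counts (measurable_finset_iff.2 fun n => ?_) hF.measurable_pos
    (fun B hB => ?_) fun k B hB hdisj => ?_
  · simp only [Finset.mem_filter, Finset.mem_range]
    exact (measurableSet_setOfPred.1 (measurableSet_lt measurable_const hF.measurable_card)).and
      (measurableSet_setOfPred.1 (hF.measurable_pos n hS))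
  · simp only [card_filter_nodes_eq_count]
    rw [hmean B hB]
    exact hF.poisson_count _ (Set.inter_subset_right.trans hSA) (hB.inter hS)
  · simp only [card_filter_nodes_eq_count]
    exact hF.indep_count k (fun j => B j ∩ S) (fun j => Set.inter_subset_right.trans hSA)
      (fun j => (hB j).inter hS)
      fun i j hij => (hdisj hij).mono Set.inter_subset_left Set.inter_subset_left

namespace HasAlohaNakagamiMarks

theorem map_tx_singleton_true (hF : F.HasAlohaNakagamiMarks μ a m) (n : ℕ) :
    μ.map (F.tx n) {true} = ENNReal.ofReal a := by
  rw [Measure.map_apply (hF.measurable_tx n) (measurableSet_singleton _)]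
  exact hF.tx_prob n

open Classical in
theorem indepFun_nodes_marks (hF : F.HasAlohaNakagamiMarks μ a m) (hS : MeasurableSet S) :
    IndepFun (fun ω => ((Finset.range (F.card ω)).filter fun n => F.pos n ω ∈ S,
      fun n => F.pos n ω)) (fun ω n => (F.tx n ω, F.gain n ω)) μ := by
  have hnodes : Measurable fun q : ℕ × (ℕ → Plane) =>
      (Finset.range q.1).filter fun n => q.2 n ∈ S := measurable_finset_iff.2 fun n => by
    simp only [Finset.mem_filter, Finset.mem_range]
    exact (measurableSet_setOfPred.1 (measurableSet_lt measurable_const measurable_fst)).and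
      (measurableSet_setOfPred.1 (((measurable_pi_apply n).comp measurable_snd) hS))
  exact hF.indep_pos_marks.comp (hnodes.prodMk measurable_snd) measurable_id

variable [IsProbabilityMeasure μ]

theorem map_tx_eq (hF : F.HasAlohaNakagamiMarks μ a m) (n k : ℕ) :
    μ.map (F.tx n) = μ.map (F.tx k) := by
  have := fun n => Measure.isProbabilityMeasure_map (μ := μ) (hF.measurable_tx n).aemeasurable
  exact ext_of_singleton_true ((hF.map_tx_singleton_true n).trans (hF.map_tx_singleton_true k).symm)

theorem map_tx_gain (hF : F.HasAlohaNakagamiMarks μ a m) (n : ℕ) :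
    μ.map (fun ω => (F.tx n ω, F.gain n ω)) = (μ.map (F.tx 0)).prod (gammaMeasure m m) := by
  rw [(indepFun_iff_map_prod_eq_prod_map_map (hF.measurable_tx n).aemeasurable
    (hF.measurable_gain n).aemeasurable).1 (hF.indep_tx_gain n), (hF.gain_law n).map_eq,
    hF.map_tx_eq n 0]

theorem isPoissonProcess_active (hF : F.HasAlohaNakagamiMarks μ a m)
    (hPPP : F.IsHomogeneousPPP μ A lam) (hlam : 0 ≤ lam) (hm : 1 ≤ m) (hS : MeasurableSet S)
    (hSA : S ⊆ A) [IsFiniteMeasure (volume.restrict S)] :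
    IsPoissonProcess (F.active S) F.posGain
      (((a * lam).toNNReal • volume.restrict S).prod (gammaMeasure m m)) μ := by
  classical
  have hm0 : (0 : ℝ) < m := by exact_mod_cast hm
  have := isProbabilityMeasure_gammaMeasure hm0 hm0
  have := Measure.isProbabilityMeasure_map (μ := μ) (hF.measurable_tx 0).aemeasurable
  let D : Set (Plane × Bool × ℝ) := {p | p.2.1 ∈ ({true} : Set Bool)}
  have hD : MeasurableSet D := (measurableSet_singleton true).preimage (by fun_prop)
  have hactive : F.active S = fun ω => ((Finset.range (F.card ω)).filter
      fun n => F.pos n ω ∈ S).filter fun n => (F.pos n ω, F.tx n ω, F.gain n ω) ∈ D := by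
    ext ω n
    simp [active, D, and_assoc]
  have hintensity : ((((lam.toNNReal • volume.restrict S).prod ((μ.map (F.tx 0)).prod
      (gammaMeasure m m))).restrict D).map fun p => (p.1, p.2.2)) =
      ((a * lam).toNNReal • volume.restrict S).prod (gammaMeasure m m) := by
    refine (map_restrict_prod_prod {true}).trans ?_
    rw [hF.map_tx_singleton_true, smul_smul, mul_comm a, Real.toNNReal_mul hlam, mul_comm]
    rfl
  rw [hactive, ← hintensity]
  exact (((hPPP.isPoissonProcess hlam hS hSA).marking
    (fun n => (hF.measurable_tx n).prodMk (hF.measurable_gain n)) hF.map_tx_gain hF.iIndep_marks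
    (hF.indepFun_nodes_marks hS)).thinning hD).mapping
      (measurable_fst.prodMk measurable_snd.snd)

end HasAlohaNakagamiMarks

end NodeField

namespace NodeField

variable {Ω : Type*} {F : NodeField Ω} {c : Plane} {R h η P noise β : ℝ}

theorem droneDist_pos (c : Plane) (hh : 0 < h) (x : Plane) : 0 < droneDist c h x :=
  Real.sqrt_pos.2 (by positivity)

theorem measurable_droneDist (c : Plane) (h : ℝ) : Measurable (droneDist c h) := by
  unfold droneDist
  fun_prop

/-- The power received from a node of given position and gain, normalized by the transmission
power. -/
noncomputable def receivedPower (c : Plane) (h η : ℝ) (p : Plane × ℝ) : ℝ :=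
  p.2 * droneDist c h p.1 ^ (-η)

theorem measurable_receivedPower (c : Plane) (h η : ℝ) : Measurable (receivedPower c h η) := by
  have := measurable_droneDist c h
  unfold receivedPower
  fun_prop

theorem receivedPower_nonneg {p : Plane × ℝ} (hp : 0 ≤ p.2) : 0 ≤ receivedPower c h η p :=
  mul_nonneg hp (Real.rpow_nonneg (Real.sqrt_nonneg _) _)

theorem interference_eq (F : NodeField Ω) (c : Plane) (R h η P noise : ℝ) (n : ℕ) (ω : Ω) :
    F.interference c R h η P noise n ω =
      reducedShotNoise (F.active (coverage c R)) F.posGain (receivedPower c h η) n ω +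
        noise / P := rfl

theorem sinr_eq (hP : P ≠ 0) (n : ℕ) (ω : Ω) :
    F.sinr c R h η P noise n ω =
      receivedPower c h η (F.posGain n ω) / F.interference c R h η P noise n ω := by
  have hdenom : (∑ j ∈ (F.active (coverage c R) ω).erase n,
      P * F.gain j ω * droneDist c h (F.pos j ω) ^ (-η)) + noise =
      P * F.interference c R h η P noise n ω := by
    rw [interference, mul_add, Finset.mul_sum, mul_div_cancel₀ _ hP]
    simp only [mul_assoc]
  rw [sinr, hdenom, mul_assoc, mul_div_mul_left _ _ hP]
  rfl

/-- The set of all `((x, g), y)` such that a transmission from `x` with gain `g` succeeds when the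
normalized power received from the other nodes is `y`. -/
def successRegion (c : Plane) (h η P noise β : ℝ) : Set ((Plane × ℝ) × ℝ) :=
  {p | β * droneDist c h p.1.1 ^ η * (p.2 + noise / P) ≤ p.1.2}

theorem measurableSet_successRegion (c : Plane) (h η P noise β : ℝ) :
    MeasurableSet (successRegion c h η P noise β) := by
  have := measurable_droneDist c h
  exact measurableSet_le (by fun_prop) (by fun_prop)

theorem interference_pos {ω : Ω} (hP : 0 < P) (hnoise : 0 < noise)
    (hgain : ∀ n ∈ F.active (coverage c R) ω, 0 ≤ F.gain n ω) (n : ℕ) :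
    0 < F.interference c R h η P noise n ω :=
  add_pos_of_nonneg_of_pos (Finset.sum_nonneg fun j hj =>
    receivedPower_nonneg (p := F.posGain j ω) (hgain j (Finset.mem_of_mem_erase hj)))
    (div_pos hnoise hP)

theorem le_sinr_iff {ω : Ω} (hP : 0 < P) (hnoise : 0 < noise)
    (hgain : ∀ n ∈ F.active (coverage c R) ω, 0 ≤ F.gain n ω) (n : ℕ) :
    β ≤ F.sinr c R h η P noise n ω ↔
      β * F.interference c R h η P noise n ω ≤ receivedPower c h η (F.posGain n ω) := by
  rw [sinr_eq hP.ne', le_div_iff₀ (interference_pos hP hnoise hgain n)]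

theorem le_sinr_iff_le_gain {ω : Ω} (hP : 0 < P) (hnoise : 0 < noise)
    (hgain : ∀ n ∈ F.active (coverage c R) ω, 0 ≤ F.gain n ω) (hh : 0 < h) (n : ℕ) :
    β ≤ F.sinr c R h η P noise n ω ↔
      β * droneDist c h (F.pos n ω) ^ η * F.interference c R h η P noise n ω ≤ F.gain n ω := by
  have hpos := droneDist_pos c hh (F.pos n ω)
  rw [le_sinr_iff hP hnoise hgain, receivedPower, posGain, Real.rpow_neg hpos.le,
    ← div_eq_mul_inv, le_div_iff₀ (Real.rpow_pos_of_pos hpos η), mul_right_comm]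

theorem receivedPower_lt_of_le_sinr {ω : Ω} (hP : 0 < P) (hnoise : 0 < noise)
    (hgain : ∀ n ∈ F.active (coverage c R) ω, 0 ≤ F.gain n ω)
    (hβ : 1 ≤ β) {n k : ℕ} (hnk : n ≠ k)
    (hk : k ∈ F.active (coverage c R) ω) (hn : β ≤ F.sinr c R h η P noise n ω) :
    receivedPower c h η (F.posGain k ω) < receivedPower c h η (F.posGain n ω) :=
  calc receivedPower c h η (F.posGain k ω)
      ≤ reducedShotNoise (F.active (coverage c R)) F.posGain (receivedPower c h η) n ω :=
        Finset.single_le_sum (f := fun j => receivedPower c h η (F.posGain j ω))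
          (fun j hj => receivedPower_nonneg (hgain j (Finset.mem_of_mem_erase hj)))
          (Finset.mem_erase.2 ⟨hnk.symm, hk⟩)
    _ < F.interference c R h η P noise n ω := by
        rw [interference_eq]
        exact lt_add_of_pos_right _ (div_pos hnoise hP)
    _ ≤ β * F.interference c R h η P noise n ω :=
        le_mul_of_one_le_left (interference_pos hP hnoise hgain n).le hβ
    _ ≤ receivedPower c h η (F.posGain n ω) := (le_sinr_iff hP hnoise hgain n).1 hn

theorem eq_of_le_sinr {ω : Ω} (hP : 0 < P) (hnoise : 0 < noise)
    (hgain : ∀ n ∈ F.active (coverage c R) ω, 0 ≤ F.gain n ω)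
    (hβ : 1 ≤ β) {n k : ℕ} (hn : n ∈ F.active (coverage c R) ω)
    (hk : k ∈ F.active (coverage c R) ω) (hns : β ≤ F.sinr c R h η P noise n ω)
    (hks : β ≤ F.sinr c R h η P noise k ω) : n = k := by
  by_contra hnk
  exact lt_asymm (receivedPower_lt_of_le_sinr hP hnoise hgain hβ hnk hk hns)
    (receivedPower_lt_of_le_sinr hP hnoise hgain hβ (Ne.symm hnk) hn hks)

theorem successCount_eq_indicator {ω : Ω} (hP : 0 < P) (hnoise : 0 < noise)
    (hgain : ∀ n ∈ F.active (coverage c R) ω, 0 ≤ F.gain n ω) (hβ : 1 ≤ β) :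
    F.successCount c R h η P noise β ω = (F.successEvent c R h η P noise β).indicator 1 ω := by
  classical
  by_cases hs : ω ∈ F.successEvent c R h η P noise β
  · obtain ⟨n, hn, hns⟩ := id hs
    rw [Set.indicator_of_mem hs, successCount, Finset.sum_eq_single_of_mem n hn fun k hk hkn =>
      if_neg fun hks => hkn (eq_of_le_sinr hP hnoise hgain hβ hk hn hks hns), if_pos hns]
    rfl
  · rw [Set.indicator_of_notMem hs]
    exact Finset.sum_eq_zero fun n hn => if_neg fun hns => hs ⟨n, hn, hns⟩

open Classical in
theorem successCount_eq_card_filter {ω : Ω} (hP : 0 < P) (hnoise : 0 < noise)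
    (hgain : ∀ n ∈ F.active (coverage c R) ω, 0 ≤ F.gain n ω) (hh : 0 < h) :
    F.successCount c R h η P noise β ω = (((F.active (coverage c R) ω).filter fun n =>
      (F.posGain n ω, reducedShotNoise (F.active (coverage c R)) F.posGain
        (receivedPower c h η) n ω) ∈ successRegion c h η P noise β).card : ℝ) := by
  simp only [successCount, le_sinr_iff_le_gain hP hnoise hgain hh, Finset.card_filter,
    Nat.cast_sum, Nat.cast_ite, Nat.cast_one, Nat.cast_zero]
  rfl

theorem successEvent_eq_preimage :
    F.successEvent c R h η P noise β = F.successCount c R h η P noise β ⁻¹' {0}ᶜ := by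
  classical
  ext ω
  simp [successEvent, successCount]

end NodeField

namespace NodeField

variable {Ω : Type*} [MeasurableSpace Ω] {μ : Measure Ω} {F : NodeField Ω} {c : Plane}
  {R h η P noise β : ℝ}

/-- The law of the total power received from the covered region, plus noise, normalized by the
transmission power. -/
noncomputable def interferenceLaw (F : NodeField Ω) (μ : Measure Ω) (c : Plane)
    (R h η P noise : ℝ) : Measure ℝ :=
  (μ.map (shotNoise (F.active (coverage c R)) F.posGain (receivedPower c h η))).map
    (· + noise / P)

section Palm

variable {Λ : Measure (Plane × ℝ)}

theorem isProbabilityMeasure_interferenceLaw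
    (hproc : IsPoissonProcess (F.active (coverage c R)) F.posGain Λ μ) :
    IsProbabilityMeasure (F.interferenceLaw μ c R h η P noise) := by
  have := hproc.isProbabilityMeasure
  have := Measure.isProbabilityMeasure_map (μ := μ)
    (hproc.measurable_shotNoise (measurable_receivedPower c h η)).aemeasurable
  exact Measure.isProbabilityMeasure_map (by fun_prop)

variable [IsFiniteMeasure Λ]

open Classical in
theorem lintegral_card_filter_interference
    (hproc : IsPoissonProcess (F.active (coverage c R)) F.posGain Λ μ) {B : Set Plane} {C : Set ℝ}
    (hB : MeasurableSet B) (hC : MeasurableSet C) :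
    ∫⁻ ω, (((F.active (coverage c R) ω).filter fun n =>
        F.pos n ω ∈ B ∧ F.interference c R h η P noise n ω ∈ C).card : ENNReal) ∂μ =
      Λ (Prod.fst ⁻¹' B) * F.interferenceLaw μ c R h η P noise C := by
  have := hproc.isProbabilityMeasure
  have hC' : MeasurableSet ((· + noise / P) ⁻¹' C) := measurable_add_const _ hC
  rw [interferenceLaw, Measure.map_apply (by fun_prop) hC, ← Measure.prod_prod,
    ← hproc.lintegral_card_filter_reducedShotNoise (measurable_receivedPower c h η)
      ((measurable_fst hB).prod hC')]
  rfl

theorem isInterferenceLaw_interferenceLaw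
    (hproc : IsPoissonProcess (F.active (coverage c R)) F.posGain Λ μ) :
    F.IsInterferenceLaw μ c R h η P noise (F.interferenceLaw μ c R h η P noise) := by
  have hprob := isProbabilityMeasure_interferenceLaw (h := h) (η := η) (P := P) (noise := noise)
    hproc
  refine ⟨hprob, fun B C hB hC => ?_⟩
  have huniv := lintegral_card_filter_interference (h := h) (η := η) (P := P) (noise := noise)
    hproc hB .univ
  rw [measure_univ, mul_one] at huniv
  rw [lintegral_card_filter_interference hproc hB hC, ← huniv]
  congr! 6
  exact and_iff_left trivial

theorem ae_gain_nonneg (hproc : IsPoissonProcess (F.active (coverage c R)) F.posGain Λ μ)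
    (hΛ : ∀ᵐ p ∂Λ, 0 ≤ p.2) : ∀ᵐ ω ∂μ, ∀ n ∈ F.active (coverage c R) ω, 0 ≤ F.gain n ω :=
  hproc.ae_forall_mem (measurableSet_Ici.preimage measurable_snd) hΛ

theorem ae_nonneg_interferenceLaw
    (hproc : IsPoissonProcess (F.active (coverage c R)) F.posGain Λ μ)
    (hΛ : ∀ᵐ p ∂Λ, 0 ≤ p.2) (hnP : 0 ≤ noise / P) :
    ∀ᵐ y ∂(F.interferenceLaw μ c R h η P noise), 0 ≤ y := by
  have hshot := hproc.measurable_shotNoise (measurable_receivedPower c h η)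
  refine (ae_map_iff (by fun_prop) measurableSet_Ici).2
    ((ae_map_iff hshot.aemeasurable (measurable_add_const _ measurableSet_Ici)).2 ?_)
  filter_upwards [ae_gain_nonneg hproc hΛ] with ω hω
  exact add_nonneg (Finset.sum_nonneg fun n hn => receivedPower_nonneg (hω n hn)) hnP

open Classical in
theorem successCount_ae_eq_card_filter
    (hproc : IsPoissonProcess (F.active (coverage c R)) F.posGain Λ μ)
    (hΛ : ∀ᵐ p ∂Λ, 0 ≤ p.2) (hP : 0 < P) (hnoise : 0 < noise) (hh : 0 < h) :
    F.successCount c R h η P noise β =ᵐ[μ] fun ω =>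
      (((F.active (coverage c R) ω).filter fun n => (F.posGain n ω,
        reducedShotNoise (F.active (coverage c R)) F.posGain (receivedPower c h η) n ω) ∈
          successRegion c h η P noise β).card : ℝ) := by
  filter_upwards [ae_gain_nonneg hproc hΛ] with ω hω
  exact successCount_eq_card_filter hP hnoise hω hh

theorem integrable_successCount
    (hproc : IsPoissonProcess (F.active (coverage c R)) F.posGain Λ μ)
    (hΛ : ∀ᵐ p ∂Λ, 0 ≤ p.2) (hP : 0 < P) (hnoise : 0 < noise) (hh : 0 < h) :
    Integrable (F.successCount c R h η P noise β) μ := by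
  classical
  exact (hproc.integrable_card_filter_reducedShotNoise (measurable_receivedPower c h η)
    (measurableSet_successRegion c h η P noise β)).congr
    (successCount_ae_eq_card_filter hproc hΛ hP hnoise hh).symm

theorem integral_successCount_eq_measureReal
    (hproc : IsPoissonProcess (F.active (coverage c R)) F.posGain Λ μ)
    (hΛ : ∀ᵐ p ∂Λ, 0 ≤ p.2) (hP : 0 < P) (hnoise : 0 < noise) (hh : 0 < h) :
    ∫ ω, F.successCount c R h η P noise β ω ∂μ =
      (Λ.prod (μ.map (shotNoise (F.active (coverage c R)) F.posGain (receivedPower c h η)))).real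
        (successRegion c h η P noise β) := by
  classical
  rw [integral_congr_ae (successCount_ae_eq_card_filter hproc hΛ hP hnoise hh)]
  exact hproc.integral_card_filter_reducedShotNoise (measurable_receivedPower c h η)
    (measurableSet_successRegion c h η P noise β)

theorem measureReal_successEvent
    (hproc : IsPoissonProcess (F.active (coverage c R)) F.posGain Λ μ)
    (hΛ : ∀ᵐ p ∂Λ, 0 ≤ p.2) (hP : 0 < P) (hnoise : 0 < noise) (hh : 0 < h) (hβ : 1 ≤ β) :
    μ.real (F.successEvent c R h η P noise β) = ∫ ω, F.successCount c R h η P noise β ω ∂μ := by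
  have hevent : NullMeasurableSet (F.successEvent c R h η P noise β) μ := by
    rw [successEvent_eq_preimage]
    exact (integrable_successCount hproc hΛ hP hnoise hh).aemeasurable.nullMeasurableSet_preimage
      (measurableSet_singleton 0).compl
  have hindicator : F.successCount c R h η P noise β =ᵐ[μ]
      (F.successEvent c R h η P noise β).indicator 1 := by
    filter_upwards [ae_gain_nonneg hproc hΛ] with ω hω
    exact successCount_eq_indicator hP hnoise hω hβ
  rw [integral_congr_ae hindicator, integral_indicator₀ hevent]
  simp

end Palm

end NodeField

namespace NodeField

variable {Ω : Type*} [MeasurableSpace Ω] {μ : Measure Ω} {F : NodeField Ω} {c : Plane}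
  {lam a R h η P noise β : ℝ} {m : ℕ}

/-- The intensity measure of the transmitting nodes of the covered region, marked by their gains,
for nodes of density `lam` transmitting with probability `a` under Nakagami-`m` fading. -/
noncomputable def activeIntensity (lam a : ℝ) (c : Plane) (R : ℝ) (m : ℕ) : Measure (Plane × ℝ) :=
  ((a * lam).toNNReal • volume.restrict (coverage c R)).prod (gammaMeasure m m)

theorem measurableSet_coverage (c : Plane) (R : ℝ) : MeasurableSet (coverage c R) :=
  measurableSet_closedBall

instance isFiniteMeasure_restrict_coverage (c : Plane) (R : ℝ) :
    IsFiniteMeasure (volume.restrict (coverage c R)) :=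
  isFiniteMeasure_restrict.2 measure_closedBall_lt_top.ne

theorem isProbabilityMeasure_gammaMeasure_natCast (hm : 1 ≤ m) :
    IsProbabilityMeasure (gammaMeasure m m) :=
  isProbabilityMeasure_gammaMeasure (by positivity) (by positivity)

theorem isFiniteMeasure_activeIntensity (hm : 1 ≤ m) :
    IsFiniteMeasure (activeIntensity lam a c R m) := by
  have := isProbabilityMeasure_gammaMeasure_natCast hm
  unfold activeIntensity
  infer_instance

theorem ae_activeIntensity_nonneg (hm : 1 ≤ m) :
    ∀ᵐ p ∂activeIntensity lam a c R m, 0 ≤ p.2 := by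
  have := isProbabilityMeasure_gammaMeasure_natCast hm
  exact Measure.quasiMeasurePreserving_snd.ae (ae_nonneg_gammaMeasure m m)

theorem integral_coverage_comp_droneDist (hlam : 0 ≤ lam) (ha : 0 ≤ a) (hh : 0 < h) (hR : 0 ≤ R)
    (c : Plane) (f : ℝ → ℝ) :
    ∫ x, f (droneDist c h x) ∂((a * lam).toNNReal • volume.restrict (coverage c R)) =
      2 * a * Real.pi * lam * ∫ r in h..Real.sqrt (h ^ 2 + R ^ 2), f r * r := by
  rw [integral_smul_nnreal_measure, setIntegral_coverage_comp_droneDist c hh hR, NNReal.smul_def,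
    Real.coe_toNNReal _ (mul_nonneg ha hlam), smul_eq_mul]
  ring

theorem integral_exp_neg_mul_receivedPower_gammaMeasure (hm : 1 ≤ m) {s : ℝ} (hs : 0 ≤ s)
    (x : Plane) :
    ∫ g, Real.exp (-s * receivedPower c h η (x, g)) ∂gammaMeasure m m =
      (1 + s * droneDist c h x ^ (-η) / m) ^ (-(m : ℤ)) := by
  have hm' : (0 : ℝ) < m := by positivity
  have hpow : 0 ≤ droneDist c h x ^ (-η) := Real.rpow_nonneg (Real.sqrt_nonneg _) _
  have hcomm : ∀ g, -s * receivedPower c h η (x, g) = -(s * droneDist c h x ^ (-η)) * g :=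
    fun g => by rw [receivedPower]; ring
  simp only [hcomm]
  rw [integral_exp_neg_mul_gammaMeasure hm' hm' (by nlinarith [mul_nonneg hs hpow]),
    ← Real.rpow_intCast, Int.cast_neg, Int.cast_natCast]

theorem integral_exp_neg_mul_receivedPower_sub_one (hlam : 0 ≤ lam) (ha : 0 ≤ a) (hh : 0 < h)
    (hR : 0 ≤ R) (hm : 1 ≤ m) {s : ℝ} (hs : 0 ≤ s) :
    ∫ p, (Real.exp (-s * receivedPower c h η p) - 1) ∂activeIntensity lam a c R m =
      -2 * Real.pi * lam * a * ∫ r in h..Real.sqrt (h ^ 2 + R ^ 2),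
        (1 - (1 + s * r ^ (-η) / m) ^ (-(m : ℤ))) * r := by
  have := isProbabilityMeasure_gammaMeasure_natCast hm
  have := isFiniteMeasure_activeIntensity (lam := lam) (a := a) (c := c) (R := R) hm
  have hexp : Integrable (fun p => Real.exp (-s * receivedPower c h η p))
      (activeIntensity lam a c R m) := by
    refine .of_bound (((measurable_receivedPower c h η).const_mul _).exp).aestronglyMeasurable 1 ?_
    filter_upwards [ae_activeIntensity_nonneg hm] with p hp
    rw [Real.norm_of_nonneg (Real.exp_nonneg _), Real.exp_le_one_iff]
    exact mul_nonpos_of_nonpos_of_nonneg (neg_nonpos.2 hs) (receivedPower_nonneg hp)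
  have hsub : Integrable (fun p => Real.exp (-s * receivedPower c h η p) - 1)
      (activeIntensity lam a c R m) := hexp.sub (integrable_const 1)
  rw [activeIntensity, integral_prod _ hsub]
  have hinner : ∀ᵐ x ∂((a * lam).toNNReal • volume.restrict (coverage c R)),
      ∫ g, (Real.exp (-s * receivedPower c h η (x, g)) - 1) ∂gammaMeasure m m =
        (1 + s * droneDist c h x ^ (-η) / m) ^ (-(m : ℤ)) - 1 := by
    filter_upwards [hexp.prod_right_ae] with x hx
    rw [integral_sub hx (integrable_const 1),
      integral_exp_neg_mul_receivedPower_gammaMeasure hm hs, integral_const, probReal_univ,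
      one_smul]
  rw [integral_congr_ae hinner, integral_coverage_comp_droneDist hlam ha hh hR c
    fun r => (1 + s * r ^ (-η) / m) ^ (-(m : ℤ)) - 1]
  simp only [← neg_sub (1 : ℝ), neg_mul, intervalIntegral.integral_neg]
  ring

theorem integral_exp_neg_mul_interferenceLaw
    (hproc : IsPoissonProcess (F.active (coverage c R)) F.posGain
      (activeIntensity lam a c R m) μ)
    (hlam : 0 ≤ lam) (ha : 0 ≤ a) (hh : 0 < h) (hR : 0 ≤ R) (hm : 1 ≤ m) {s : ℝ} (hs : 0 ≤ s) :
    ∫ y, Real.exp (-s * y) ∂F.interferenceLaw μ c R h η P noise =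
      laplaceI lam a η P noise h (Real.sqrt (h ^ 2 + R ^ 2)) m s := by
  have := isFiniteMeasure_activeIntensity (lam := lam) (a := a) (c := c) (R := R) hm
  have hw := measurable_receivedPower c h η
  have hw0 : ∀ᵐ p ∂activeIntensity lam a c R m, 0 ≤ receivedPower c h η p :=
    (ae_activeIntensity_nonneg hm).mono fun p => receivedPower_nonneg
  rw [interferenceLaw, integral_map (by fun_prop) (by fun_prop),
    integral_map (hproc.measurable_shotNoise hw).aemeasurable (by fun_prop)]
  simp only [mul_add, Real.exp_add]
  rw [integral_mul_const, hproc.integral_exp_neg_mul_shotNoise hw hw0 hs,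
    integral_exp_neg_mul_receivedPower_sub_one hlam ha hh hR hm hs, laplaceI, mul_comm,
    mul_div_assoc]

theorem integral_successCount
    (hproc : IsPoissonProcess (F.active (coverage c R)) F.posGain
      (activeIntensity lam a c R m) μ)
    (hlam : 0 ≤ lam) (ha : 0 ≤ a) (hβ : 0 < β) (hP : 0 < P) (hnoise : 0 < noise) (hh : 0 < h)
    (hR : 0 ≤ R) (hm : 1 ≤ m) :
    ∫ ω, F.successCount c R h η P noise β ω ∂μ =
      2 * a * Real.pi * lam * ∫ r in h..Real.sqrt (h ^ 2 + R ^ 2),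
        (∑ k ∈ Finset.range m, (-(m * β * r ^ η)) ^ k / (k.factorial : ℝ) *
          iteratedDeriv k (laplaceI lam a η P noise h (Real.sqrt (h ^ 2 + R ^ 2)) m)
            (m * β * r ^ η)) * r := by
  have := hproc.isProbabilityMeasure
  have := isProbabilityMeasure_gammaMeasure_natCast hm
  have := isFiniteMeasure_activeIntensity (lam := lam) (a := a) (c := c) (R := R) hm
  have := isProbabilityMeasure_interferenceLaw (h := h) (η := η) (P := P) (noise := noise) hproc
  have hgain := ae_activeIntensity_nonneg (lam := lam) (a := a) (c := c) (R := R) hm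
  have hdist := measurable_droneDist c h
  have hsuccess : ∀ x, ∫ y, (gammaMeasure m m).real
      (Set.Ici (β * droneDist c h x ^ η * (y + noise / P)))
        ∂μ.map (shotNoise (F.active (coverage c R)) F.posGain (receivedPower c h η)) =
      ∑ k ∈ Finset.range m, (-(m * β * droneDist c h x ^ η)) ^ k / (k.factorial : ℝ) *
        iteratedDeriv k (laplaceI lam a η P noise h (Real.sqrt (h ^ 2 + R ^ 2)) m)
          (m * β * droneDist c h x ^ η) := fun x => by
    rw [mul_assoc (m : ℝ), ← integral_gammaMeasure_real_Ici
      (ae_nonneg_interferenceLaw hproc hgain (div_pos hnoise hP).le)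
      (fun s => integral_exp_neg_mul_interferenceLaw hproc hlam ha hh hR hm) hm (by positivity)
      (mul_pos hβ (Real.rpow_pos_of_pos (droneDist_pos c hh x) η)), interferenceLaw,
      (measurableEmbedding_addRight (noise / P)).integral_map]
  rw [integral_successCount_eq_measureReal hproc hgain hP hnoise hh, activeIntensity,
    successRegion, measureReal_prod_prod_setOf_le
      (ψ := fun q => β * droneDist c h q.1 ^ η * (q.2 + noise / P)) (by fun_prop)]
  simp only [hsuccess]
  exact integral_coverage_comp_droneDist hlam ha hh hR c fun r =>
    ∑ k ∈ Finset.range m, (-(m * β * r ^ η)) ^ k / (k.factorial : ℝ) *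
      iteratedDeriv k (laplaceI lam a η P noise h (Real.sqrt (h ^ 2 + R ^ 2)) m) (m * β * r ^ η)

end NodeField

theorem theorem1_general {Ω : Type*} [MeasurableSpace Ω] {μ : Measure Ω} [IsProbabilityMeasure μ]
    {F : NodeField Ω} {A : Set Plane} {c : Plane} {lam a β η P noise h R d : ℝ} {m : ℕ}
    (hlam : 0 ≤ lam) (ha : 0 ≤ a) (hβ : 0 < β) (hP : 0 < P) (hnoise : 0 < noise) (hh : 0 < h)
    (hR : 0 ≤ R) (hm : 1 ≤ m) (hd : d = Real.sqrt (h ^ 2 + R ^ 2))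
    (hcov : NodeField.coverage c R ⊆ A) (hPPP : F.IsHomogeneousPPP μ A lam)
    (hmarks : F.HasAlohaNakagamiMarks μ a m) :
    Integrable (F.successCount c R h η P noise β) μ ∧
    (1 ≤ β → μ.real (F.successEvent c R h η P noise β) =
      ∫ ω, F.successCount c R h η P noise β ω ∂μ) ∧
    ∫ ω, F.successCount c R h η P noise β ω ∂μ =
      2 * a * Real.pi * lam * ∫ r in h..d,
        (∑ k ∈ Finset.range m, (-(m * β * r ^ η)) ^ k / (k.factorial : ℝ) *
          iteratedDeriv k (laplaceI lam a η P noise h d m) (m * β * r ^ η)) * r ∧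
    ∃ Q : Measure ℝ, F.IsInterferenceLaw μ c R h η P noise Q ∧
      ∀ s : ℝ, 0 ≤ s → ∫ y, Real.exp (-s * y) ∂Q = laplaceI lam a η P noise h d m s := by
  subst hd
  have hproc : IsPoissonProcess (F.active (NodeField.coverage c R)) F.posGain
      (NodeField.activeIntensity lam a c R m) μ :=
    hmarks.isPoissonProcess_active hPPP hlam hm (NodeField.measurableSet_coverage c R) hcov
  have := NodeField.isFiniteMeasure_activeIntensity (lam := lam) (a := a) (c := c) (R := R) hm
  have hgain := NodeField.ae_activeIntensity_nonneg (lam := lam) (a := a) (c := c) (R := R) hm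
  exact ⟨NodeField.integrable_successCount hproc hgain hP hnoise hh,
    NodeField.measureReal_successEvent hproc hgain hP hnoise hh,
    NodeField.integral_successCount hproc hlam ha hβ hP hnoise hh hR hm,
    F.interferenceLaw μ c R h η P noise, NodeField.isInterferenceLaw_interferenceLaw hproc,
    fun _ => NodeField.integral_exp_neg_mul_interferenceLaw hproc hlam ha hh hR hm⟩

theorem theorem1 {Ω : Type*} [MeasurableSpace Ω] (μ : Measure Ω) [IsProbabilityMeasure μ]
    (F : NodeField Ω) (A : Set Plane) (c : Plane) (lam a β η P noise h R d : ℝ) (m : ℕ)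
    (hlam : 0 < lam) (ha0 : 0 ≤ a) (ha1 : a ≤ 1) (hβ : 1 ≤ β) (hη : 0 < η) (hP : 0 < P)
    (hnoise : 0 < noise) (hh : 0 < h) (hR : 0 < R) (hm : 1 ≤ m)
    (hd : d = Real.sqrt (h ^ 2 + R ^ 2))
    (hA : MeasurableSet A) (hAfin : volume A ≠ ⊤) (hcov : NodeField.coverage c R ⊆ A)
    (hPPP : F.IsHomogeneousPPP μ A lam) (hmarks : F.HasAlohaNakagamiMarks μ a m) :
    Integrable (F.successCount c R h η P noise β) μ ∧
    μ.real (F.successEvent c R h η P noise β) = ∫ ω, F.successCount c R h η P noise β ω ∂μ ∧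
    μ.real (F.successEvent c R h η P noise β) =
      2 * a * Real.pi * lam * ∫ r in h..d,
        (∑ k ∈ Finset.range m, (-(m * β * r ^ η)) ^ k / (k.factorial : ℝ) *
          iteratedDeriv k (laplaceI lam a η P noise h d m) (m * β * r ^ η)) * r ∧
    ∃ Q : Measure ℝ, F.IsInterferenceLaw μ c R h η P noise Q ∧
      ∀ s : ℝ, 0 ≤ s → ∫ y, Real.exp (-s * y) ∂Q = laplaceI lam a η P noise h d m s := by
  obtain ⟨hint, hprob, hmean, hQ⟩ := theorem1_general hlam.le ha0 (one_pos.trans_le hβ) hP hnoise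
    hh hR.le hm hd hcov hPPP hmarks
  exact ⟨hint, hprob hβ, (hprob hβ).trans hmean, hQ⟩
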